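/- A lattice $d$-polytope is a $d$-dimensional polytope $P\subset\mathbb R^d$ whose vertices lie in $\mathbb Z^d$. Two such polytopes $P,P'\subset\mathbb R^d$ are integrally equivalent if some affine bijection of $\mathbb R^d$ maps $\mathbb Z^d$ bijectively onto $\mathbb Z^d$ and $P$ onto $P'$. For a vertex $u$ of $P$, the normal cone of $P$ at $u$ is $$\sigma(P,u)=\{y\in(\mathbb R^d)^* : \langle y,x-u\rangle\ge 0\ \text{for all } x\in P\},$$ a pointed rational $d$-dimensional cone. Let $v_1,\dots,v_r$ be its primitive generators, that is, the primitive vectors of the dual lattice $(\mathbb Z^d)^*$ that span its extreme rays. The cone is called $\mathbb Q$-Gorenstein if there is a linear functional taking the value $1$ on all $v_i$, and its multiplicity is the normalized volume ($d!$ times the Euclidean volume) of its nib $\operatorname{conv}(0,v_1,\dots,v_r)$. Let $d$, $m$ and $N$ be nonnegative integers. Then, up to integral equivalence, there are only finitely many lattice $d$-polytopes with exactly $N+1$ lattice points such that the normal cone at every vertex is $\mathbb Q$-Gorenstein of multiplicity at most $m$. -/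

import Mathlib

open scoped Nat ENNReal

noncomputable section

namespace LatticePoly

/-- The real vector of an integer vector. -/
def toReal {d : ℕ} (z : Fin d → ℤ) : Fin d → ℝ := fun i => (z i : ℝ)

/-- The lattice `ℤ^d` inside `ℝ^d`. -/
def intLattice (d : ℕ) : Set (Fin d → ℝ) := Set.range (toReal (d := d))

/-- A lattice polytope in `ℝ^d`: the convex hull of finitely many points of `ℤ^d`. -/
def IsLatticePolytope {d : ℕ} (P : Set (Fin d → ℝ)) : Prop :=
  ∃ V : Finset (Fin d → ℤ), P = convexHull ℝ (toReal '' (V : Set (Fin d → ℤ)))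

/-- Integral equivalence of `P ⊆ ℝ^d` and `P' ⊆ ℝ^d'`: an affine map `aff P → aff P'` carries
`ℤ^d ∩ aff P` bijectively onto `ℤ^d' ∩ aff P'` and maps `P` onto `P'`. (An affine map on `aff P` is
the restriction of an affine map on the whole space.) -/
def IntegrallyEquivalent {d d' : ℕ} (P : Set (Fin d → ℝ)) (P' : Set (Fin d' → ℝ)) : Prop :=
  ∃ f : (Fin d → ℝ) →ᵃ[ℝ] (Fin d' → ℝ),
    Set.BijOn f (intLattice d ∩ (affineSpan ℝ P : Set (Fin d → ℝ)))
      (intLattice d' ∩ (affineSpan ℝ P' : Set (Fin d' → ℝ))) ∧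
    f '' P = P'

/-- The tangent cone `T_u P = cone (u' - u | u' ∈ P)`. -/
def tangentCone {d : ℕ} (P : Set (Fin d → ℝ)) (u : Fin d → ℝ) : PointedCone ℝ (Fin d → ℝ) :=
  PointedCone.hull ℝ ((fun x => x - u) '' P)

/-- The normal cone `σ(P, u)`: the dual of the tangent cone. The dual space of `ℝ^d`, with the
lattice dual to `ℤ^d`, is identified with `ℝ^d` and `ℤ^d` through the dot product. -/
def normalCone {d : ℕ} (P : Set (Fin d → ℝ)) (u : Fin d → ℝ) : PointedCone ℝ (Fin d → ℝ) :=
  PointedCone.dual (dotProductBilin ℝ ℝ) (tangentCone P u : Set (Fin d → ℝ))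

/-- The primitive generators of a cone `σ`: the primitive vectors of `ℤ^d` that span an extreme
ray (a one-dimensional face) of `σ`. -/
def primitiveGenerators {d : ℕ} (σ : PointedCone ℝ (Fin d → ℝ)) : Set (Fin d → ℝ) :=
  {x | ∃ v : Fin d → ℤ, toReal v = x ∧ Finset.univ.gcd v = 1 ∧
    (PointedCone.hull ℝ {x}).IsFaceOf σ}

/-- `σ` is `ℚ`-Gorenstein: its primitive generators lie in an affine hyperplane of the form
`{x | h x = 1}`; the functional `h` is the height of `σ`. -/
def IsQGorenstein {d : ℕ} (σ : PointedCone ℝ (Fin d → ℝ)) : Prop :=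
  ∃ h : Module.Dual ℝ (Fin d → ℝ), ∀ v ∈ primitiveGenerators σ, h v = 1

/-- The nib of `σ`: the convex hull of `0` and the primitive generators. -/
def nib {d : ℕ} (σ : PointedCone ℝ (Fin d → ℝ)) : Set (Fin d → ℝ) :=
  convexHull ℝ (insert 0 (primitiveGenerators σ))

/-- The multiplicity of a `d`-dimensional cone `σ` in `ℝ^d`: the normalized volume of its nib,
that is, `d!` times the Lebesgue measure. -/
def multiplicity {d : ℕ} (σ : PointedCone ℝ (Fin d → ℝ)) : ℝ≥0∞ :=
  (d ! : ℝ≥0∞) * MeasureTheory.volume (nib σ)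

/-- The lattice `d`-polytopes `P ⊆ ℝ^d` with `N + 1` lattice points whose normal cones
at the vertices are `ℚ`-Gorenstein of multiplicity at most `m`. -/
def boundedGorensteinPolytopes (d m N : ℕ) : Set (Set (Fin d → ℝ)) :=
  {P | IsLatticePolytope P ∧ affineSpan ℝ P = ⊤ ∧ (P ∩ intLattice d).ncard = N + 1 ∧
    ∀ u ∈ Set.extremePoints ℝ P,
      IsQGorenstein (normalCone P u) ∧ multiplicity (normalCone P u) ≤ (m : ℝ≥0∞)}

end LatticePoly

end

namespace LatticePoly

variable {d : ℕ}

/-! Linearly independent primitive edge vectors `b` at a vertex `u` give coordinates in which `ℤ^d`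
becomes an overlattice of the standard lattice, of index `|det b|`. If this determinant and the
coordinates of all lattice points of `P` are bounded in terms of `d`, `m`, `N`, only finitely many
pictures occur, and a picture determines `P` up to integral equivalence
(`integrallyEquivalent_of_hasCode`).

Determinants: a scaled parallelepiped on any `d` generators of the normal cone fits into its nib, so
the multiplicity bounds their determinants (`natAbs_det_le_of_multiplicity_le`). Such a bound passes
to the primitive edge vectors, which generate the dual cone (`natAbs_det_le_of_dual`).

Coordinates: along an edge `w` the tangent cones at the two ends agree modulo `w`. Hence enough
edges `e'` at the far end have the form `a e + μ w` with `e` an edge at the near end; together with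
`-w` they span (`IsLatticePointSet.separates_insert_adjacentVectors`). A lattice triangle inside `P`
contains at most `N + 1` lattice points, which bounds `a` and `μ`
(`IsLatticePointSet.bounds_of_adjacent`). Cramer's rule with the determinant bound controls the
remaining edges at the far end. So one step in the vertex graph multiplies all sizes by at most a
constant, and boundedly many steps reach every vertex (`IsLatticePointSet.norm_sub_le`). -/

@[simp] theorem toReal_apply (z : Fin d → ℤ) (i : Fin d) : toReal z i = (z i : ℝ) := rfl

theorem toReal_injective : Function.Injective (toReal (d := d)) := fun a b h => by
  ext i; simpa using congrFun h i

@[simp] theorem toReal_zero : toReal (0 : Fin d → ℤ) = 0 := by ext; simp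

@[simp] theorem toReal_add (a b : Fin d → ℤ) : toReal (a + b) = toReal a + toReal b := by
  ext; simp

@[simp] theorem toReal_sub (a b : Fin d → ℤ) : toReal (a - b) = toReal a - toReal b := by
  ext; simp

@[simp] theorem toReal_neg (a : Fin d → ℤ) : toReal (-a) = -toReal a := by ext; simp

@[simp] theorem toReal_smul (n : ℤ) (a : Fin d → ℤ) : toReal (n • a) = (n : ℝ) • toReal a := by
  ext; simp

theorem toReal_dotProduct (a b : Fin d → ℤ) : toReal a ⬝ᵥ toReal b = ((a ⬝ᵥ b : ℤ) : ℝ) := by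
  simp [dotProduct]

/-! ### Rational cones and their extreme rays -/

/-- The cone cut out by the inequalities `0 ≤ ⟨z, y⟩`, `z ∈ Z`. -/
def dualCone (Z : Set (Fin d → ℤ)) : PointedCone ℝ (Fin d → ℝ) :=
  PointedCone.dual (dotProductBilin ℝ ℝ) (toReal '' Z)

theorem mem_dualCone {Z : Set (Fin d → ℤ)} {y : Fin d → ℝ} :
    y ∈ dualCone Z ↔ ∀ z ∈ Z, 0 ≤ toReal z ⬝ᵥ y := by
  simp [dualCone, dotProductBilin]

/-- `w` is a primitive integer vector spanning an extreme ray of `C`. -/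
structure IsExtremeVector (C : PointedCone ℝ (Fin d → ℝ)) (w : Fin d → ℤ) : Prop where
  gcd_eq : Finset.univ.gcd w = 1
  mem : toReal w ∈ C
  mem_span_left : ∀ x ∈ C, ∀ y ∈ C, x + y ∈ Submodule.span ℝ {toReal w} →
    x ∈ Submodule.span ℝ {toReal w}

/-- No nonzero vector is orthogonal to all of `Z`. -/
def Separates (Z : Set (Fin d → ℤ)) : Prop :=
  ∀ x : Fin d → ℝ, (∀ z ∈ Z, toReal z ⬝ᵥ x = 0) → x = 0

theorem Separates.salient {Z : Set (Fin d → ℤ)} (h : Separates Z) {x : Fin d → ℝ}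
    (h1 : x ∈ dualCone Z) (h2 : -x ∈ dualCone Z) : x = 0 := by
  refine h x fun z hz => le_antisymm ?_ (mem_dualCone.1 h1 z hz)
  have := mem_dualCone.1 h2 z hz
  rw [dotProduct_neg] at this
  linarith

theorem ne_zero_of_gcd {w : Fin d → ℤ} (h : Finset.univ.gcd w = 1) : w ≠ 0 := by
  rintro rfl
  have : Finset.univ.gcd (0 : Fin d → ℤ) = 0 := Finset.gcd_eq_zero_iff.2 (by simp)
  rw [h] at this
  exact one_ne_zero this

theorem toReal_ne_zero {w : Fin d → ℤ} (h : w ≠ 0) : toReal w ≠ 0 := fun h' =>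
  h (toReal_injective (by simpa using h'))

/-- The ratio test: only constraints on which `p` is negative limit the step, and none of these is
tight at `y`. The longest admissible step makes one of them tight. -/
theorem exists_pos_step {Z : Set (Fin d → ℤ)} (hZ : Z.Finite) {y p : Fin d → ℝ}
    (hy : y ∈ dualCone Z) (hp : ∀ z ∈ Z, toReal z ⬝ᵥ y = 0 → 0 ≤ toReal z ⬝ᵥ p) :
    ∃ t : ℝ, 0 < t ∧ y + t • p ∈ dualCone Z ∧
      ((∃ z ∈ Z, toReal z ⬝ᵥ p < 0) →
        ∃ z ∈ Z, toReal z ⬝ᵥ p < 0 ∧ toReal z ⬝ᵥ (y + t • p) = 0) := by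
  classical
  by_cases hne : ∃ z ∈ Z, toReal z ⬝ᵥ p < 0
  · let W := hZ.toFinset.filter (fun z => toReal z ⬝ᵥ p < 0)
    have hW : W.Nonempty := by
      obtain ⟨z, hz, h⟩ := hne
      exact ⟨z, by simp [W, hz, h]⟩
    obtain ⟨z₀, hz₀, hmin⟩ :=
      W.exists_min_image (fun z => (toReal z ⬝ᵥ y) / (-(toReal z ⬝ᵥ p))) hW
    simp only [W, Finset.mem_filter, Set.Finite.mem_toFinset] at hz₀ hmin
    have hpos : 0 < toReal z₀ ⬝ᵥ y := by
      refine lt_of_le_of_ne (mem_dualCone.1 hy _ hz₀.1) fun h => ?_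
      exact absurd (hp z₀ hz₀.1 h.symm) (not_le.2 hz₀.2)
    refine ⟨(toReal z₀ ⬝ᵥ y) / (-(toReal z₀ ⬝ᵥ p)), div_pos hpos (by linarith [hz₀.2]), ?_,
      fun _ => ⟨z₀, hz₀.1, hz₀.2, ?_⟩⟩
    · refine mem_dualCone.2 fun z hz => ?_
      rw [dotProduct_add, dotProduct_smul, smul_eq_mul]
      rcases lt_or_ge (toReal z ⬝ᵥ p) 0 with h | h
      · have := hmin z ⟨hz, h⟩
        rw [le_div_iff₀ (by linarith)] at this
        linarith
      · have := mem_dualCone.1 hy z hz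
        have h2 : 0 ≤ (toReal z₀ ⬝ᵥ y) / (-(toReal z₀ ⬝ᵥ p)) :=
          div_nonneg hpos.le (by linarith [hz₀.2])
        positivity
    · rw [dotProduct_add, dotProduct_smul, smul_eq_mul]
      have := hz₀.2.ne
      field_simp
      ring
  · push Not at hne
    refine ⟨1, one_pos, mem_dualCone.2 fun z hz => ?_, fun ⟨z, hz, h⟩ => absurd (hne z hz) (not_le.2 h)⟩
    rw [one_smul, dotProduct_add]
    exact add_nonneg (mem_dualCone.1 hy z hz) (hne z hz)

/-- Short steps from `w` along `p` and `-p` stay in the cone, and a positive combination of the two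
endpoints is a multiple of `w`, so extremality applies. -/
theorem IsExtremeVector.mem_span_of_tight {Z : Set (Fin d → ℤ)} (hZ : Z.Finite)
    {w : Fin d → ℤ} (hw : IsExtremeVector (dualCone Z) w) {p : Fin d → ℝ}
    (hp : ∀ z ∈ Z, toReal z ⬝ᵥ toReal w = 0 → toReal z ⬝ᵥ p = 0) :
    p ∈ Submodule.span ℝ {toReal w} := by
  obtain ⟨t, ht, h1, -⟩ := exists_pos_step hZ hw.mem (fun z hz h => (hp z hz h).ge)
  obtain ⟨s, hs, h2, -⟩ := exists_pos_step (p := -p) hZ hw.mem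
    (fun z hz h => by rw [dotProduct_neg, hp z hz h]; simp)
  have key := hw.mem_span_left _ (PointedCone.smul_mem _ hs.le h1) _
    (PointedCone.smul_mem _ ht.le h2) (by
      have : s • (toReal w + t • p) + t • (toReal w + s • -p) = (s + t) • toReal w := by
        module
      rw [this]
      exact Submodule.smul_mem _ _ (Submodule.mem_span_singleton_self _))
  have h3 : p = (s * t)⁻¹ • (s • (toReal w + t • p) - s • toReal w) := by
    have : s • (toReal w + t • p) - s • toReal w = (s * t) • p := by module
    rw [this, smul_smul, inv_mul_cancel₀ (by positivity), one_smul]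
  rw [h3]
  exact Submodule.smul_mem _ _ (Submodule.sub_mem _ key
    (Submodule.smul_mem _ _ (Submodule.mem_span_singleton_self _)))

theorem exists_primitive_of_rational (q : Fin d → ℚ) (hq : q ≠ 0) :
    ∃ (w : Fin d → ℤ) (c : ℚ), c ≠ 0 ∧ Finset.univ.gcd w = 1 ∧ ∀ i, q i = c * w i := by
  classical
  obtain ⟨i₀, hi₀⟩ := Function.ne_iff.1 hq
  obtain ⟨b, hb⟩ := IsLocalization.exist_integer_multiples_of_finset (nonZeroDivisors ℤ)
    (Finset.univ.image q)
  have hb0 : ((b : ℤ) : ℚ) ≠ 0 := by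
    exact_mod_cast nonZeroDivisors.ne_zero b.2
  choose n hn using fun i => hb (q i) (by simp)
  have hn' : ∀ i, (n i : ℚ) = (b : ℤ) * q i := fun i => by simpa using hn i
  obtain ⟨w, hw, hg⟩ := Finset.extract_gcd (s := Finset.univ) n ⟨i₀, Finset.mem_univ _⟩
  have hn0 : n i₀ ≠ 0 := by
    intro h
    have := hn' i₀
    rw [h] at this
    simp [hb0] at this
    exact hi₀ this
  have hG : (Finset.univ.gcd n) ≠ 0 := fun h => hn0 (Finset.gcd_eq_zero_iff.1 h i₀ (by simp))
  refine ⟨w, ((b : ℤ) : ℚ)⁻¹ * ((Finset.univ.gcd n : ℤ) : ℚ), ?_, hg, fun i => ?_⟩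
  · have : ((Finset.univ.gcd n : ℤ) : ℚ) ≠ 0 := by exact_mod_cast hG
    positivity
  · have h1 := hn' i
    rw [hw i (by simp)] at h1
    push_cast at h1
    field_simp
    linarith

theorem gcd_neg {w : Fin d → ℤ} : Finset.univ.gcd (-w) = Finset.univ.gcd w := by
  refine dvd_antisymm_of_normalize_eq Finset.normalize_gcd Finset.normalize_gcd ?_ ?_ <;>
  · refine Finset.dvd_gcd fun i hi => ?_
    first
    | exact (dvd_neg.1 (Finset.gcd_dvd hi : _ ∣ (-w) i))
    | exact (dvd_neg.2 (Finset.gcd_dvd hi : _ ∣ w i))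

/-- A line cut out by integer equations is rational: a `ℚ`-linear functional `ℝ → ℚ`, applied to
each coordinate of `y`, preserves the equations and yields a rational point of the line, nonzero
when the functional does not kill `y i₀`. -/
theorem exists_primitive_of_line {Z : Set (Fin d → ℤ)} {y : Fin d → ℝ} (hy : y ≠ 0)
    (hZ : ∀ z ∈ Z, toReal z ⬝ᵥ y = 0)
    (h : ∀ p : Fin d → ℝ, (∀ z ∈ Z, toReal z ⬝ᵥ p = 0) → p ∈ Submodule.span ℝ {y}) :
    ∃ (w : Fin d → ℤ) (c : ℝ), 0 < c ∧ Finset.univ.gcd w = 1 ∧ y = c • toReal w := by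
  obtain ⟨i₀, hi₀⟩ := Function.ne_iff.1 hy
  obtain ⟨g, hg⟩ : ∃ g : Module.Dual ℚ ℝ, g (y i₀) ≠ 0 := by
    by_contra! hcon
    exact hi₀ ((Module.forall_dual_apply_eq_zero_iff ℚ _).1 hcon)
  obtain ⟨w, c, hc, hw, hq⟩ := exists_primitive_of_rational (fun i => g (y i))
    (fun h => hg (congrFun h i₀))
  have hort : ∀ z ∈ Z, toReal z ⬝ᵥ toReal w = 0 := by
    intro z hz
    have h1 := congrArg g (hZ z hz)
    have h2 : ∑ i, (z i : ℚ) * g (y i) = 0 := by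
      rw [← map_zero g, ← h1, dotProduct, map_sum]
      refine Finset.sum_congr rfl fun i _ => ?_
      have : toReal z i * y i = (z i : ℚ) • y i := by simp [Rat.smul_def]
      rw [this, map_smul, smul_eq_mul]
    have h3 : c * ∑ i, (z i : ℚ) * w i = 0 := by
      rw [← h2, Finset.mul_sum]
      exact Finset.sum_congr rfl fun i _ => by rw [hq i]; ring
    have h4 := (mul_eq_zero.1 h3).resolve_left hc
    rw [toReal_dotProduct]
    have : (z ⬝ᵥ w : ℤ) = 0 := by
      rw [dotProduct]; exact_mod_cast h4
    rw [this]; simp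
  obtain ⟨a, ha⟩ := Submodule.mem_span_singleton.1 (h _ hort)
  have ha0 : a ≠ 0 := by
    rintro rfl
    rw [zero_smul] at ha
    exact toReal_ne_zero (ne_zero_of_gcd hw) ha.symm
  have hya : y = a⁻¹ • toReal w := by rw [← ha, smul_smul, inv_mul_cancel₀ ha0, one_smul]
  rcases lt_or_gt_of_ne ha0 with h | h
  · refine ⟨-w, -a⁻¹, by simpa using h, by rwa [gcd_neg], ?_⟩
    rw [toReal_neg, smul_neg, neg_smul, neg_neg, hya]
  · exact ⟨w, a⁻¹, by positivity, hw, hya⟩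

theorem isExtremeVector_of_tight {Z : Set (Fin d → ℤ)} {w : Fin d → ℤ}
    (hw : Finset.univ.gcd w = 1) (hmem : toReal w ∈ dualCone Z)
    (h : ∀ p : Fin d → ℝ, (∀ z ∈ Z, toReal z ⬝ᵥ toReal w = 0 → toReal z ⬝ᵥ p = 0) →
      p ∈ Submodule.span ℝ {toReal w}) : IsExtremeVector (dualCone Z) w := by
  refine ⟨hw, hmem, fun x hx y hy hxy => h x fun z hz hzw => ?_⟩
  obtain ⟨a, ha⟩ := Submodule.mem_span_singleton.1 hxy
  have h1 := mem_dualCone.1 hx z hz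
  have h2 := mem_dualCone.1 hy z hz
  have h3 : toReal z ⬝ᵥ x + toReal z ⬝ᵥ y = 0 := by
    rw [← dotProduct_add, ← ha, dotProduct_smul, hzw, smul_zero]
  linarith

/-- The Minkowski–Weyl theorem for rational pointed cones. -/
theorem mem_hull_extremeVectors {Z : Set (Fin d → ℤ)} (hZ : Z.Finite) (hs : Separates Z)
    {y : Fin d → ℝ} (hy : y ∈ dualCone Z) :
    y ∈ PointedCone.hull ℝ (toReal '' {w | IsExtremeVector (dualCone Z) w}) := by
  classical
  -- Either `y` splits into two elements of the cone with more tight constraints, or the constraints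
  -- tight at `y` cut out a line, which is then an extreme ray.
  induction hn : (hZ.toFinset.filter fun z => toReal z ⬝ᵥ y ≠ 0).card using
    Nat.strong_induction_on generalizing y with
  | _ n ih =>
  have ih' : ∀ y' ∈ dualCone Z, (∀ z ∈ Z, toReal z ⬝ᵥ y = 0 → toReal z ⬝ᵥ y' = 0) →
      (∃ z ∈ Z, toReal z ⬝ᵥ y ≠ 0 ∧ toReal z ⬝ᵥ y' = 0) →
      y' ∈ PointedCone.hull ℝ (toReal '' {w | IsExtremeVector (dualCone Z) w}) := by
    intro y' hy' h1 ⟨z, hz, h2, h3⟩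
    refine ih _ ?_ hy' rfl
    rw [← hn]
    refine Finset.card_lt_card (Finset.ssubset_iff_of_subset ?_ |>.2 ⟨z, ?_, ?_⟩)
    · intro z hz
      simp only [Finset.mem_filter, Set.Finite.mem_toFinset] at hz ⊢
      exact ⟨hz.1, fun h => hz.2 (h1 z hz.1 h)⟩
    · simp [hz, h2]
    · simp [h3]
  by_cases hy0 : y = 0
  · rw [hy0]; exact zero_mem _
  by_cases hex : ∃ y' ∈ dualCone Z, y' ≠ 0 ∧ (∀ z ∈ Z, toReal z ⬝ᵥ y = 0 → toReal z ⬝ᵥ y' = 0) ∧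
      (∃ z ∈ Z, toReal z ⬝ᵥ y ≠ 0 ∧ toReal z ⬝ᵥ y' = 0)
  · obtain ⟨y', hy', hne, h1, h2⟩ := hex
    have hpos : ∃ z ∈ Z, toReal z ⬝ᵥ (-y') < 0 := by
      by_contra! hcon
      refine hne (hs y' fun z hz => le_antisymm ?_ (mem_dualCone.1 hy' z hz))
      have := hcon z hz
      rw [dotProduct_neg] at this
      linarith
    obtain ⟨t, ht, h3, h4⟩ := exists_pos_step (p := -y') hZ hy
      (fun z hz h => by rw [dotProduct_neg, h1 z hz h]; simp)
    obtain ⟨z, hz, h5, h6⟩ := h4 hpos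
    have e : y = t • y' + (y + t • -y') := by module
    rw [e]
    refine add_mem (PointedCone.smul_mem _ ht.le (ih' y' hy' h1 h2))
      (ih' _ h3 (fun z hz h => ?_) ⟨z, hz, fun h => ?_, h6⟩)
    · rw [dotProduct_add, dotProduct_smul, dotProduct_neg, h, h1 z hz h]; simp
    · rw [dotProduct_neg, h1 z hz h] at h5; simp at h5
  · have hline : ∀ p : Fin d → ℝ, (∀ z ∈ Z, toReal z ⬝ᵥ y = 0 → toReal z ⬝ᵥ p = 0) →
        p ∈ Submodule.span ℝ {y} := by
      have aux : ∀ p : Fin d → ℝ, (∀ z ∈ Z, toReal z ⬝ᵥ y = 0 → toReal z ⬝ᵥ p = 0) →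
        (∃ z ∈ Z, toReal z ⬝ᵥ p < 0) → p ∈ Submodule.span ℝ {y} := by
        intro p hp hpn
        by_contra hcon
        obtain ⟨t, ht, h3, h4⟩ := exists_pos_step (p := p) hZ hy (fun z hz h => (hp z hz h).ge)
        obtain ⟨z, hz, h5, h6⟩ := h4 hpn
        refine hex ⟨_, h3, fun h0 => hcon ?_, fun z hz h => ?_, z, hz, fun h => ?_, h6⟩
        · have : p = (-t⁻¹) • y := by
            rw [eq_neg_of_add_eq_zero_left h0, smul_neg, neg_smul, neg_neg, smul_smul,
              inv_mul_cancel₀ ht.ne', one_smul]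
          rw [this]
          exact Submodule.smul_mem _ _ (Submodule.mem_span_singleton_self _)
        · rw [dotProduct_add, dotProduct_smul, h, hp z hz h]; simp
        · rw [hp z hz h] at h5; exact lt_irrefl _ h5
      intro p hp
      by_cases h1 : ∃ z ∈ Z, toReal z ⬝ᵥ p < 0
      · exact aux p hp h1
      by_cases h2 : ∃ z ∈ Z, toReal z ⬝ᵥ (-p) < 0
      · exact neg_mem_iff.1 (aux (-p) (fun z hz h => by rw [dotProduct_neg, hp z hz h, neg_zero]) h2)
      push Not at h1 h2
      have : p = 0 := hs.salient (mem_dualCone.2 h1) (mem_dualCone.2 h2)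
      rw [this]; exact zero_mem _
    obtain ⟨w, c, hc, hw, hyw⟩ := exists_primitive_of_line
      (Z := {z | z ∈ Z ∧ toReal z ⬝ᵥ y = 0}) hy0 (fun z hz => hz.2)
      (fun p hp => hline p fun z hz h => hp z ⟨hz, h⟩)
    have hwy : toReal w = c⁻¹ • y := by
      rw [hyw, smul_smul, inv_mul_cancel₀ hc.ne', one_smul]
    have hwext : IsExtremeVector (dualCone Z) w := by
      refine isExtremeVector_of_tight hw ?_ fun p hp => ?_
      · rw [hwy]; exact PointedCone.smul_mem _ (by positivity) hy
      · have := hline p fun z hz h => hp z hz (by rw [hwy, dotProduct_smul, h, smul_zero])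
        rw [hyw] at this
        obtain ⟨a, ha⟩ := Submodule.mem_span_singleton.1 this
        rw [← ha, smul_smul]
        exact Submodule.smul_mem _ _ (Submodule.mem_span_singleton_self _)
    rw [hyw]
    exact PointedCone.smul_mem _ hc.le (PointedCone.subset_hull ⟨w, hwext, rfl⟩)

/-- Proportionality gives `v i * w j = v j * w i`; taking gcds over `j`, primitivity makes `v i` and
`w i` divide each other. -/
theorem eq_or_eq_neg_of_mem_span {v w : Fin d → ℤ} (hv : Finset.univ.gcd v = 1)
    (hw : Finset.univ.gcd w = 1) (h : toReal v ∈ Submodule.span ℝ {toReal w}) :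
    v = w ∨ v = -w := by
  obtain ⟨a, ha⟩ := Submodule.mem_span_singleton.1 h
  have hne := ne_zero_of_gcd hw
  obtain ⟨i, hi⟩ := Function.ne_iff.1 hne
  have hcross : ∀ j, v i * w j = v j * w i := fun j => by
    have h1 := congrFun ha i
    have h2 := congrFun ha j
    simp only [Pi.smul_apply, toReal_apply, smul_eq_mul] at h1 h2
    have : (v i : ℝ) * w j = v j * w i := by rw [← h1, ← h2]; ring
    exact_mod_cast this
  have h1 : v i ∣ w i := by
    have : v i ∣ Finset.univ.gcd (fun j => w i * v j) :=
      Finset.dvd_gcd fun j _ => ⟨w j, by rw [hcross j]; ring⟩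
    rw [Finset.gcd_mul_left, hv, mul_one] at this
    exact this.trans (normalize_dvd_iff.2 dvd_rfl)
  have h2 : w i ∣ v i := by
    have : w i ∣ Finset.univ.gcd (fun j => v i * w j) :=
      Finset.dvd_gcd fun j _ => ⟨v j, by rw [hcross j]; ring⟩
    rw [Finset.gcd_mul_left, hw, mul_one] at this
    exact this.trans (normalize_dvd_iff.2 dvd_rfl)
  rcases Int.natAbs_eq_natAbs_iff.1 (Int.natAbs_eq_of_dvd_dvd h1 h2) with h | h
  · left
    ext j
    have := hcross j
    rw [h, mul_comm] at this
    exact (mul_right_cancel₀ hi this).symm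
  · right
    ext j
    have := hcross j
    rw [h] at this
    have : w i * (v j + w j) = 0 := by linarith
    have := (mul_eq_zero.1 this).resolve_left hi
    simp only [Pi.neg_apply]
    linarith

theorem IsExtremeVector.eq_of_mem_span {C : PointedCone ℝ (Fin d → ℝ)}
    (hC : ∀ x ∈ C, -x ∈ C → x = 0) {v w : Fin d → ℤ} (hv : IsExtremeVector C v)
    (hw : IsExtremeVector C w) (h : toReal v ∈ Submodule.span ℝ {toReal w}) : v = w := by
  refine (eq_or_eq_neg_of_mem_span hv.gcd_eq hw.gcd_eq h).resolve_right fun h' => ?_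
  refine toReal_ne_zero (ne_zero_of_gcd hw.gcd_eq) (hC _ hw.mem ?_)
  rw [← toReal_neg, ← h']
  exact hv.mem

/-- An extreme vector is determined by the subset of `Z` that is tight at it. -/
theorem finite_extremeVectors {Z : Set (Fin d → ℤ)} (hZ : Z.Finite) (hs : Separates Z) :
    {w | IsExtremeVector (dualCone Z) w}.Finite := by
  refine Set.Finite.of_finite_image (f := fun w => {z | z ∈ Z ∧ toReal z ⬝ᵥ toReal w = 0})
    (hZ.finite_subsets.subset ?_) ?_
  · rintro _ ⟨w, -, rfl⟩ z hz
    exact hz.1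
  · intro v hv w hw h
    refine hv.eq_of_mem_span (fun x h1 h2 => hs.salient h1 h2) hw
      (hw.mem_span_of_tight hZ fun z hz hzw => ?_)
    have : z ∈ {z | z ∈ Z ∧ toReal z ⬝ᵥ toReal v = 0} := by
      rw [show {z | z ∈ Z ∧ toReal z ⬝ᵥ toReal v = 0} = _ from h]; exact ⟨hz, hzw⟩
    exact this.2

/-! ### Determinant bounds and duality -/

theorem det_map_toReal (v : Fin d → Fin d → ℤ) :
    (Matrix.of fun i => toReal (v i)).det = ((Matrix.of v).det : ℝ) := by
  have : (Matrix.of fun i => toReal (v i)) = (Matrix.of v).map (Int.castRingHom ℝ) := by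
    ext; simp
  rw [this, ← RingHom.mapMatrix_apply, ← RingHom.map_det]
  simp

/-- Separating means spanning: a functional that kills the span of `Z` is the dot product with a
vector orthogonal to `Z`. -/
theorem exists_det_ne_zero_of_separates {Z : Set (Fin d → ℤ)} (hs : Separates Z) :
    ∃ v : Fin d → Fin d → ℤ, (∀ i, v i ∈ Z) ∧ (Matrix.of v).det ≠ 0 := by
  have hspan : Submodule.span ℝ (toReal '' Z) = ⊤ := by
    by_contra hcon
    obtain ⟨f, hf, hle⟩ := Submodule.exists_le_ker_of_lt_top _ (lt_top_iff_ne_top.2 hcon)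
    have hx := (dotProductEquiv ℝ (Fin d)).apply_symm_apply f
    set x := (dotProductEquiv ℝ (Fin d)).symm f
    refine hf ?_
    rw [← hx, hs x fun z hz => ?_, map_zero]
    have h1 : f (toReal z) = 0 := hle (Submodule.subset_span ⟨z, hz, rfl⟩)
    rw [← hx] at h1
    rw [dotProduct_comm]
    simpa using h1
  obtain ⟨f, hf, -, hli⟩ := Submodule.exists_fun_fin_finrank_span_eq ℝ (toReal '' Z)
  have hfr : Module.finrank ℝ (Submodule.span ℝ (toReal '' Z)) = d := by
    rw [hspan, finrank_top]; simp
  choose v hv hvf using fun i : Fin d => hf (Fin.cast hfr.symm i)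
  refine ⟨v, hv, fun h0 => ?_⟩
  have hli' : LinearIndependent ℝ (fun i => toReal (v i)) := by
    simp only [hvf]
    exact hli.comp _ (Fin.cast_injective _)
  have hM : IsUnit (Matrix.of fun i => toReal (v i)) :=
    Matrix.linearIndependent_rows_iff_isUnit.1 hli'
  rw [Matrix.isUnit_iff_isUnit_det, isUnit_iff_ne_zero] at hM
  exact hM (by rw [det_map_toReal, h0, Int.cast_zero])

/-- Determinants of generators are bounded by the multiplicity. -/
theorem natAbs_det_le_of_multiplicity_le {σ : PointedCone ℝ (Fin d → ℝ)} {m : ℕ}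
    (hm : multiplicity σ ≤ m) (v : Fin d → Fin d → ℤ)
    (hv : ∀ i, toReal (v i) ∈ primitiveGenerators σ) :
    (Matrix.of v).det.natAbs ≤ m * d ^ d := by
  set L := Matrix.toLin' (Matrix.of fun i => toReal (v i)).transpose with hL
  have hLx : ∀ x, L x = ∑ i, x i • toReal (v i) := fun x => by
    ext j
    simp [hL, Matrix.mulVec, dotProduct, mul_comm]
  -- With coefficients at most `1/d`, the sum is the average of `d` points on the segments from `0`
  -- to the generators. This is the source of the factor `d ^ d`.
  have hsub : L '' Set.Icc 0 (fun _ => (d : ℝ)⁻¹) ⊆ nib σ := by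
    rintro _ ⟨x, hx, rfl⟩
    have hconv : Convex ℝ (nib σ) := convex_convexHull _ _
    have h0 : (0 : Fin d → ℝ) ∈ nib σ := subset_convexHull _ _ (Set.mem_insert _ _)
    rw [hLx]
    rcases Nat.eq_zero_or_pos d with rfl | hd
    · simpa using h0
    · have hd' : (0 : ℝ) < d := by exact_mod_cast hd
      have e : ∑ i, x i • toReal (v i) = ∑ i, (d : ℝ)⁻¹ • ((d * x i) • toReal (v i)) := by
        refine Finset.sum_congr rfl fun i _ => ?_
        rw [smul_smul]; congr 1; field_simp
      rw [e]
      refine hconv.sum_mem (fun i _ => by positivity) (by simp [hd'.ne']) fun i _ => ?_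
      refine hconv.smul_mem_of_zero_mem h0
        (subset_convexHull _ _ (Set.mem_insert_of_mem _ (hv i))) ⟨?_, ?_⟩
      · have := hx.1 i
        simp only [Pi.zero_apply] at this
        positivity
      · have := hx.2 i
        rw [← mul_inv_cancel₀ hd'.ne']
        exact mul_le_mul_of_nonneg_left this hd'.le
  have hvol := MeasureTheory.measure_mono (μ := MeasureTheory.volume) hsub
  rw [MeasureTheory.Measure.addHaar_image_linearMap, hL, LinearMap.det_toLin',
    Matrix.det_transpose, det_map_toReal, Real.volume_Icc_pi] at hvol
  have h2 : MeasureTheory.volume (nib σ) ≤ m := by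
    refine le_trans ?_ hm
    rw [multiplicity]
    refine le_mul_of_one_le_left (zero_le) ?_
    exact_mod_cast Nat.one_le_iff_ne_zero.2 (Nat.factorial_ne_zero d)
  have h3 := hvol.trans h2
  simp only [Pi.zero_apply, sub_zero, Finset.prod_const, Finset.card_univ, Fintype.card_fin] at h3
  rw [← ENNReal.ofReal_pow (by positivity), ← ENNReal.ofReal_mul (by positivity),
    ← ENNReal.ofReal_natCast, ENNReal.ofReal_le_ofReal_iff (by positivity)] at h3
  have h4 : |((Matrix.of v).det : ℝ)| ≤ m * d ^ d := by
    rcases Nat.eq_zero_or_pos d with rfl | hd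
    · simpa using h3
    · have hd' : (0 : ℝ) < d := by exact_mod_cast hd
      rwa [inv_pow, ← div_eq_mul_inv, div_le_iff₀ (by positivity)] at h3
  rw [← Int.cast_abs, Int.abs_eq_natAbs] at h4
  exact_mod_cast h4

theorem IsExtremeVector.toReal_mem_primitiveGenerators {C : PointedCone ℝ (Fin d → ℝ)}
    (hC : ∀ x ∈ C, -x ∈ C → x = 0) {w : Fin d → ℤ} (hw : IsExtremeVector C w) :
    toReal w ∈ primitiveGenerators C := by
  refine ⟨w, rfl, hw.gcd_eq, ?_, ?_⟩
  · exact Submodule.span_le.2 (by simpa using hw.mem)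
  · intro x y a hx hy ha hxy
    have h1 := hw.mem_span_left (a • x) (PointedCone.smul_mem _ ha.le hx) y hy
      (PointedCone.hull_le_span _ _ hxy)
    obtain ⟨c, hc⟩ := Submodule.mem_span_singleton.1 h1
    have hx' : x = (a⁻¹ * c) • toReal w := by
      rw [mul_smul, hc, smul_smul, inv_mul_cancel₀ ha.ne', one_smul]
    rw [hx']
    refine PointedCone.smul_mem _ ?_ (PointedCone.subset_hull rfl)
    by_contra! hneg
    refine toReal_ne_zero (ne_zero_of_gcd hw.gcd_eq) (hC _ hw.mem ?_)
    have : -toReal w = (-(a⁻¹ * c)⁻¹) • x := by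
      rw [hx', smul_smul, neg_mul, inv_mul_cancel₀ hneg.ne, neg_smul, one_smul]
    rw [this]
    exact PointedCone.smul_mem _ (by simpa using (inv_lt_zero.2 hneg).le) hx

/-- The pairing of extreme vectors of dual cones is bounded by the determinants. -/
theorem dotProduct_le_of_det_le {F : Set (Fin d → ℤ)} (hF : F.Finite) {K : ℕ}
    (hK : ∀ v : Fin d → Fin d → ℤ, (∀ i, v i ∈ F) → (Matrix.of v).det.natAbs ≤ K)
    {w : Fin d → ℤ} (hw : IsExtremeVector (dualCone F) w) {v : Fin d → ℤ} (hv : v ∈ F) :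
    (v ⬝ᵥ w).natAbs ≤ K := by
  by_cases h0 : v ⬝ᵥ w = 0
  · simp [h0]
  -- The vectors tight at `w` leave only the line of `w` orthogonal to them, and `v` is not
  -- orthogonal to `w`.
  have hs' : Separates (insert v {z | z ∈ F ∧ toReal z ⬝ᵥ toReal w = 0}) := by
    intro x hx
    obtain ⟨a, ha⟩ := Submodule.mem_span_singleton.1 (hw.mem_span_of_tight hF (p := x)
      fun z hz h => hx z (Or.inr ⟨hz, h⟩))
    have h1 := hx v (Or.inl rfl)
    rw [← ha, dotProduct_smul, toReal_dotProduct, smul_eq_mul] at h1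
    rcases mul_eq_zero.1 h1 with h2 | h2
    · rw [← ha, h2, zero_smul]
    · exact absurd (by exact_mod_cast h2) h0
  obtain ⟨u, hu, hdet⟩ := exists_det_ne_zero_of_separates hs'
  have hdvd : ∀ i, v ⬝ᵥ w ∣ u i ⬝ᵥ w := by
    intro i
    rcases hu i with h | h
    · rw [h]
    · have := h.2
      rw [toReal_dotProduct] at this
      have : u i ⬝ᵥ w = 0 := by exact_mod_cast this
      rw [this]
      exact dvd_zero _
  -- All entries of `u w` are divisible by `v ⬝ᵥ w`, hence so are those of `adj(u) u w = det(u) w`;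
  -- since `w` is primitive, `det u` itself is divisible.
  have h2 : ∀ j, v ⬝ᵥ w ∣ (Matrix.of u).det * w j := by
    intro j
    have h3 : (Matrix.of u).adjugate.mulVec ((Matrix.of u).mulVec w) = (Matrix.of u).det • w := by
      rw [Matrix.mulVec_mulVec, Matrix.adjugate_mul, Matrix.smul_mulVec, Matrix.one_mulVec]
    have h4 := congrFun h3 j
    rw [Pi.smul_apply, smul_eq_mul] at h4
    rw [← h4, Matrix.mulVec, dotProduct]
    exact Finset.dvd_sum fun i _ => Dvd.dvd.mul_left (hdvd i) _
  have h3 : v ⬝ᵥ w ∣ (Matrix.of u).det := by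
    have : v ⬝ᵥ w ∣ Finset.univ.gcd (fun j => (Matrix.of u).det * w j) :=
      Finset.dvd_gcd fun j _ => h2 j
    rw [Finset.gcd_mul_left, hw.gcd_eq, mul_one] at this
    exact this.trans (normalize_dvd_iff.2 dvd_rfl)
  refine le_trans (Nat.le_of_dvd (Int.natAbs_pos.2 hdet) (Int.natAbs_dvd_natAbs.2 h3)) (hK u ?_)
  intro i
  rcases hu i with h | h
  · rw [h]; exact hv
  · exact h.1

/-- For `d` independent rows `v` from `F`, the matrix of pairings `v wᵀ` has entries at most `K`.
Its determinant is `det v * det w`, and `det v` is a nonzero integer. -/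
theorem natAbs_det_le_of_dual {F : Set (Fin d → ℤ)} (hF : F.Finite) (hs : Separates F) {K : ℕ}
    (hK : ∀ v : Fin d → Fin d → ℤ, (∀ i, v i ∈ F) → (Matrix.of v).det.natAbs ≤ K)
    (w : Fin d → Fin d → ℤ) (hw : ∀ i, IsExtremeVector (dualCone F) (w i)) :
    (Matrix.of w).det.natAbs ≤ d ! * K ^ d := by
  obtain ⟨v, hv, hdet⟩ := exists_det_ne_zero_of_separates hs
  have h1 : ((Matrix.of v) * (Matrix.of w).transpose).det.natAbs ≤ d ! * K ^ d := by
    have := Matrix.det_le (abv := (AbsoluteValue.abs : AbsoluteValue ℤ ℤ)) (x := (K : ℤ))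
      (A := (Matrix.of v) * (Matrix.of w).transpose) (fun i j => by
        have := dotProduct_le_of_det_le hF hK (hw j) (hv i)
        rw [AbsoluteValue.abs_apply, Int.abs_eq_natAbs]
        have e : ((Matrix.of v) * (Matrix.of w).transpose) i j = v i ⬝ᵥ w j := by
          simp [Matrix.mul_apply, dotProduct]
        rw [e]
        exact_mod_cast this)
    rw [AbsoluteValue.abs_apply, Int.abs_eq_natAbs, Fintype.card_fin, nsmul_eq_mul] at this
    exact_mod_cast this
  rw [Matrix.det_mul, Matrix.det_transpose, Int.natAbs_mul] at h1
  exact le_trans (Nat.le_mul_of_pos_left _ (Int.natAbs_pos.2 hdet)) h1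

/-! ### Facet and edge vectors of a cone -/

/-- The primitive generators of the cone dual to `Z`. -/
def facetVectors (Z : Set (Fin d → ℤ)) : Set (Fin d → ℤ) := {v | IsExtremeVector (dualCone Z) v}

/-- The primitive generators of the bidual of `Z`. -/
def edgeVectors (Z : Set (Fin d → ℤ)) : Set (Fin d → ℤ) :=
  {w | IsExtremeVector (dualCone (facetVectors Z)) w}

/-- `Z` lies, apart from `0`, strictly on one side of a hyperplane through `0`. -/
def IsStrictlySupported (Z : Set (Fin d → ℤ)) : Prop :=
  ∃ f : Fin d → ℝ, ∀ z ∈ Z, z ≠ 0 → 0 < toReal z ⬝ᵥ f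

theorem dotProduct_nonneg_of_mem {Z : Set (Fin d → ℤ)} (hZ : Z.Finite) (hs : Separates Z)
    {y x : Fin d → ℝ} (hy : y ∈ dualCone Z) (hx : x ∈ dualCone (facetVectors Z)) :
    0 ≤ y ⬝ᵥ x := by
  have h := mem_hull_extremeVectors hZ hs hy
  rw [dualCone, ← PointedCone.dual_hull] at hx
  exact hx h

theorem mem_dualCone_facetVectors {Z : Set (Fin d → ℤ)} {z : Fin d → ℤ} (hz : z ∈ Z) :
    toReal z ∈ dualCone (facetVectors Z) := by
  refine mem_dualCone.2 fun v hv => ?_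
  rw [dotProduct_comm]
  exact mem_dualCone.1 hv.mem z hz

/-- A strictly supporting functional `f` can be moved a little towards `x` inside the dual cone. If
`x` is orthogonal to the facet vectors, it is orthogonal to the whole dual cone, hence to itself. -/
theorem separates_facetVectors {Z : Set (Fin d → ℤ)} (hZ : Z.Finite) (hs : Separates Z)
    (hp : IsStrictlySupported Z) : Separates (facetVectors Z) := by
  intro x hx
  have horth : ∀ y ∈ dualCone Z, y ⬝ᵥ x = 0 := fun y hy => by
    have h1 := dotProduct_nonneg_of_mem hZ hs hy (mem_dualCone.2 fun v hv => (hx v hv).ge)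
    have h2 := dotProduct_nonneg_of_mem (x := -x) hZ hs hy
      (mem_dualCone.2 fun v hv => by rw [dotProduct_neg, hx v hv, neg_zero])
    rw [dotProduct_neg] at h2
    linarith
  obtain ⟨f, hf⟩ := hp
  have hfσ : f ∈ dualCone Z := mem_dualCone.2 fun z hz => by
    by_cases h : z = 0
    · simp [h]
    · exact (hf z hz h).le
  obtain ⟨t, ht, h1, -⟩ := exists_pos_step (p := x) hZ hfσ fun z hz h => by
    have : z = 0 := by
      by_contra hne
      exact (hf z hz hne).ne' h
    simp [this]
  have h2 := horth _ h1
  rw [add_dotProduct, smul_dotProduct, horth f hfσ, zero_add, smul_eq_mul] at h2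
  exact dotProduct_self_eq_zero.1 ((mul_eq_zero.1 h2).resolve_left ht.ne')

theorem exists_eq_zsmul_of_mem_span {z w : Fin d → ℤ} (hw : Finset.univ.gcd w = 1)
    (h : toReal z ∈ Submodule.span ℝ {toReal w}) : ∃ n : ℤ, z = n • w := by
  by_cases hz : z = 0
  · exact ⟨0, by simp [hz]⟩
  obtain ⟨i, hi⟩ := Function.ne_iff.1 hz
  obtain ⟨z', hz', hg⟩ := Finset.extract_gcd (s := Finset.univ) z ⟨i, Finset.mem_univ _⟩
  have hG : Finset.univ.gcd z ≠ 0 := fun h => hi (Finset.gcd_eq_zero_iff.1 h i (by simp))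
  have e : z = Finset.univ.gcd z • z' := by ext j; simpa using hz' j (by simp)
  have h' : toReal z' ∈ Submodule.span ℝ {toReal w} := by
    rw [e, toReal_smul] at h
    exact (Submodule.smul_mem_iff _ (by exact_mod_cast hG)).1 h
  rcases eq_or_eq_neg_of_mem_span hg hw h' with h1 | h1
  · exact ⟨_, by rw [← h1]; exact e⟩
  · refine ⟨-Finset.univ.gcd z, ?_⟩
    rw [neg_smul, ← smul_neg, ← h1]; exact e

/-- A functional supporting exactly the ray of an edge vector. -/
theorem exists_support_of_mem_edgeVectors {Z : Set (Fin d → ℤ)} (hZ : Z.Finite) (hs : Separates Z)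
    {w : Fin d → ℤ} (hw : w ∈ edgeVectors Z) :
    ∃ f : Fin d → ℝ, f ∈ dualCone Z ∧ toReal w ⬝ᵥ f = 0 ∧
      ∀ z ∈ Z, toReal z ⬝ᵥ f = 0 → toReal z ∈ Submodule.span ℝ {toReal w} := by
  classical
  have hF := finite_extremeVectors hZ hs
  let W := hF.toFinset.filter fun v => toReal v ⬝ᵥ toReal w = 0
  have hW : ∀ v, v ∈ W ↔ v ∈ facetVectors Z ∧ toReal v ⬝ᵥ toReal w = 0 := fun v => by
    simp [W, facetVectors]
  have hdot : ∀ x : Fin d → ℝ, x ⬝ᵥ (∑ v ∈ W, toReal v) = ∑ v ∈ W, toReal v ⬝ᵥ x := fun x => by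
    rw [dotProduct_sum]
    exact Finset.sum_congr rfl fun v _ => dotProduct_comm _ _
  have hnn : ∀ z ∈ Z, ∀ v ∈ W, 0 ≤ toReal v ⬝ᵥ toReal z := fun z hz v hv =>
    mem_dualCone.1 (mem_dualCone_facetVectors hz) v ((hW v).1 hv).1
  -- The sum of the facet vectors tight at `w`: it vanishes at a point of `Z` only if every summand
  -- does.
  refine ⟨∑ v ∈ W, toReal v, mem_dualCone.2 fun z hz => ?_, ?_, fun z hz h => ?_⟩
  · rw [hdot]
    exact Finset.sum_nonneg (hnn z hz)
  · rw [hdot]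
    exact Finset.sum_eq_zero fun v hv => ((hW v).1 hv).2
  · rw [hdot, Finset.sum_eq_zero_iff_of_nonneg (hnn z hz)] at h
    exact hw.mem_span_of_tight hF fun v hv hvw => h v ((hW v).2 ⟨hv, hvw⟩)

/-- Every edge vector is a positive multiple of an element of `Z`. -/
theorem exists_pos_smul_of_mem_edgeVectors {Z : Set (Fin d → ℤ)} (hZ : Z.Finite)
    (hs : Separates Z) (hp : IsStrictlySupported Z) {w : Fin d → ℤ} (hw : w ∈ edgeVectors Z) :
    ∃ n : ℤ, 0 < n ∧ n • w ∈ Z := by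
  by_contra! hcon
  obtain ⟨f, hf, hfw, hfz⟩ := exists_support_of_mem_edgeVectors hZ hs hw
  have hzero : ∀ z ∈ Z, toReal z ⬝ᵥ f = 0 → z = 0 := by
    intro z hz h
    obtain ⟨n, rfl⟩ := exists_eq_zsmul_of_mem_span hw.gcd_eq (hfz z hz h)
    rcases lt_trichotomy n 0 with hn | hn | hn
    · exfalso
      refine toReal_ne_zero (ne_zero_of_gcd hw.gcd_eq)
        ((separates_facetVectors hZ hs hp).salient hw.mem ?_)
      have hn' : (n : ℝ) < 0 := by exact_mod_cast hn
      have : -toReal w = (-(n : ℝ)⁻¹) • toReal (n • w) := by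
        rw [toReal_smul, smul_smul, neg_mul, inv_mul_cancel₀ hn'.ne, neg_smul, one_smul]
      rw [this]
      exact PointedCone.smul_mem _ (by simpa using (inv_lt_zero.2 hn').le)
        (mem_dualCone_facetVectors hz)
    · rw [hn, zero_smul]
    · exact absurd hz (hcon n hn)
  -- Now `f` is positive on `Z` away from `0`, so it can be tilted by `-w` within the dual cone; but
  -- the tilted functional is negative on `w`.
  obtain ⟨t, ht, h1, -⟩ := exists_pos_step (p := -toReal w) hZ hf fun z hz h => by
    rw [hzero z hz h]; simp
  have h2 := dotProduct_nonneg_of_mem hZ hs h1 hw.mem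
  rw [add_dotProduct, smul_dotProduct, neg_dotProduct, dotProduct_comm f, hfw, smul_eq_mul] at h2
  have h3 : 0 < toReal w ⬝ᵥ toReal w := by
    refine lt_of_le_of_ne (Finset.sum_nonneg fun i _ => mul_self_nonneg _) fun h => ?_
    exact toReal_ne_zero (ne_zero_of_gcd hw.gcd_eq) (dotProduct_self_eq_zero.1 h.symm)
  nlinarith

/-! ### Vertices and their neighbors -/

/-- The translate `V - u`. -/
def shift (V : Set (Fin d → ℤ)) (u : Fin d → ℤ) : Set (Fin d → ℤ) := {z | u + z ∈ V}

theorem mem_shift {V : Set (Fin d → ℤ)} {u z : Fin d → ℤ} : z ∈ shift V u ↔ u + z ∈ V := Iff.rfl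

theorem finite_shift {V : Set (Fin d → ℤ)} (hV : V.Finite) (u : Fin d → ℤ) :
    (shift V u).Finite := hV.preimage (add_right_injective u).injOn

/-- `u` is an exposed point of the convex hull of `V`. -/
def IsVertex (V : Set (Fin d → ℤ)) (u : Fin d → ℤ) : Prop :=
  u ∈ V ∧ IsStrictlySupported (shift V u)

/-- A point `u` of maximal Euclidean norm works, exposed by the functional `-u`. -/
theorem exists_isVertex {V : Set (Fin d → ℤ)} (hV : V.Finite) (hne : V.Nonempty) :
    ∃ u, IsVertex V u := by
  obtain ⟨u, hu, hmax⟩ := V.exists_max_image (fun u => toReal u ⬝ᵥ toReal u) hV hne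
  refine ⟨u, hu, -toReal u, fun z hz hz0 => ?_⟩
  have h1 := hmax _ hz
  simp only [toReal_add, add_dotProduct, dotProduct_add] at h1
  have h3 : 0 < toReal z ⬝ᵥ toReal z := by
    refine lt_of_le_of_ne (Finset.sum_nonneg fun i _ => mul_self_nonneg _) fun h => ?_
    exact toReal_ne_zero hz0 (dotProduct_self_eq_zero.1 h.symm)
  rw [dotProduct_comm (toReal u) (toReal z)] at h1
  rw [dotProduct_neg]
  linarith

theorem IsVertex.mem_extremePoints {V : Set (Fin d → ℤ)} {u : Fin d → ℤ} (hu : IsVertex V u) :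
    toReal u ∈ Set.extremePoints ℝ (convexHull ℝ (toReal '' V)) := by
  obtain ⟨huV, f, hf⟩ := hu
  have hsub : convexHull ℝ (toReal '' V) ⊆ {x | x = toReal u ∨ toReal u ⬝ᵥ f < x ⬝ᵥ f} := by
    refine convexHull_min ?_ ?_
    · rintro _ ⟨v, hv, rfl⟩
      by_cases h : v = u
      · left; rw [h]
      · right
        have := hf (v - u) (by simpa [shift] using hv) (sub_ne_zero.2 h)
        rw [toReal_sub, sub_dotProduct] at this
        linarith
    · rintro x hx y hy a b ha hb hab
      rcases ha.eq_or_lt with rfl | ha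
      · rw [zero_add] at hab; subst hab; simpa using hy
      rcases hb.eq_or_lt with rfl | hb
      · rw [add_zero] at hab; subst hab; simpa using hx
      have hu : toReal u ⬝ᵥ f = a * (toReal u ⬝ᵥ f) + b * (toReal u ⬝ᵥ f) := by
        rw [← add_mul, hab, one_mul]
      rcases hx with rfl | hx <;> rcases hy with rfl | hy
      · left; rw [← add_smul, hab, one_smul]
      all_goals
        right
        simp only [add_dotProduct, smul_dotProduct, smul_eq_mul]
        rw [hu]
        nlinarith
  refine ⟨subset_convexHull _ _ ⟨u, huV, rfl⟩, ?_⟩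
  rintro x hx y hy ⟨a, b, ha, hb, hab, hxy⟩
  have h1 := hsub hx
  have h2 := hsub hy
  refine h1.resolve_right fun h1 => ?_
  have h2' : toReal u ⬝ᵥ f ≤ y ⬝ᵥ f := by
    rcases h2 with rfl | h2
    · exact le_rfl
    · exact h2.le
  have h3 : a * (x ⬝ᵥ f) + b * (y ⬝ᵥ f) = toReal u ⬝ᵥ f := by
    rw [← hxy]; simp [add_dotProduct]
  have hu : toReal u ⬝ᵥ f = a * (toReal u ⬝ᵥ f) + b * (toReal u ⬝ᵥ f) := by
    rw [← add_mul, hab, one_mul]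
  nlinarith

/-- The last point of `V` on the ray from `u` along `w` is exposed by a functional supporting the
edge, tilted slightly by `-w`. -/
theorem exists_neighbor {V : Set (Fin d → ℤ)} (hV : V.Finite) {u : Fin d → ℤ} (hu : IsVertex V u)
    (hs : Separates (shift V u)) {w : Fin d → ℤ} (hw : w ∈ edgeVectors (shift V u)) :
    ∃ l : ℤ, 0 < l ∧ IsVertex V (u + l • w) := by
  have hZ := finite_shift hV u
  obtain ⟨n, hn, hnV⟩ := exists_pos_smul_of_mem_edgeVectors hZ hs hu.2 hw
  have hw0 := ne_zero_of_gcd hw.gcd_eq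
  have hww : 0 < toReal w ⬝ᵥ toReal w := by
    refine lt_of_le_of_ne (Finset.sum_nonneg fun i _ => mul_self_nonneg _) fun h => ?_
    exact toReal_ne_zero hw0 (dotProduct_self_eq_zero.1 h.symm)
  obtain ⟨l, hl, hmax⟩ := Set.exists_max_image {n : ℤ | n • w ∈ shift V u} id
    (hZ.preimage (smul_left_injective ℤ hw0).injOn) ⟨n, hnV⟩
  have hl0 : 0 < l := hn.trans_le (hmax n hnV)
  refine ⟨l, hl0, hl, ?_⟩
  obtain ⟨f, hf, hfw, hfz⟩ := exists_support_of_mem_edgeVectors hZ hs hw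
  have hmem : ∀ z ∈ shift V (u + l • w), z + l • w ∈ shift V u := fun z hz => by
    rw [mem_shift] at hz ⊢
    rwa [add_comm z, ← add_assoc]
  have hval : ∀ z, toReal (z + l • w) ⬝ᵥ f = toReal z ⬝ᵥ f := fun z => by
    rw [toReal_add, toReal_smul, add_dotProduct, smul_dotProduct, hfw]; simp
  have htight : ∀ z ∈ shift V (u + l • w), toReal z ⬝ᵥ f = 0 → ∃ k : ℤ, k ≤ 0 ∧ z = k • w := by
    intro z hz h
    rw [← hval] at h
    obtain ⟨k, hk⟩ := exists_eq_zsmul_of_mem_span hw.gcd_eq (hfz _ (hmem z hz) h)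
    have hkl : k ≤ l := hmax k (by
      have := hmem z hz
      rwa [hk] at this)
    refine ⟨k - l, by linarith, ?_⟩
    rw [sub_smul, ← hk]; simp
  have hfσ : f ∈ dualCone (shift V (u + l • w)) := mem_dualCone.2 fun z hz => by
    rw [← hval]
    exact mem_dualCone.1 hf _ (hmem z hz)
  have hneg : ∀ k : ℤ, toReal (k • w) ⬝ᵥ (-toReal w) = (-k) * (toReal w ⬝ᵥ toReal w) := fun k => by
    rw [toReal_smul, smul_dotProduct, dotProduct_neg, smul_eq_mul]; ring
  obtain ⟨t, ht, h1, -⟩ := exists_pos_step (p := -toReal w) (finite_shift hV _) hfσ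
    fun z hz h => by
      obtain ⟨k, hk, rfl⟩ := htight z hz h
      rw [hneg]
      have : (k : ℝ) ≤ 0 := by exact_mod_cast hk
      exact mul_nonneg (by linarith) hww.le
  -- Half the admissible step gives strict inequality wherever `f` is positive; on the edge the tilt
  -- itself is positive.
  refine ⟨f + (t / 2) • (-toReal w), fun z hz hz0 => ?_⟩
  have h2 := mem_dualCone.1 h1 z hz
  have h3 := mem_dualCone.1 hfσ z hz
  rw [dotProduct_add, dotProduct_smul, smul_eq_mul] at h2 ⊢
  rcases h3.eq_or_lt with h | h
  · obtain ⟨k, hk, rfl⟩ := htight z hz h.symm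
    rw [← h, hneg]
    have hk0 : k ≠ 0 := by rintro rfl; simp at hz0
    have : (k : ℝ) < 0 := by exact_mod_cast lt_of_le_of_ne hk hk0
    have : 0 < -(k : ℝ) := by linarith
    positivity
  · linarith

/-! ### Tangent cones at the two ends of an edge -/

/-- Two finite generating sets of a salient cone share, up to scaling, a generating subset. -/
theorem exists_common_generators {Q : Type*} [AddCommGroup Q] [Module ℝ Q] {G G' : Set Q}
    (hG : G.Finite) (hGG' : PointedCone.hull ℝ G = PointedCone.hull ℝ G')
    (hsal : ∀ x ∈ PointedCone.hull ℝ G, -x ∈ PointedCone.hull ℝ G → x = 0) :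
    ∃ I ⊆ G, PointedCone.hull ℝ I = PointedCone.hull ℝ G ∧
      ∀ g ∈ I, ∃ a : ℝ, 0 < a ∧ a • g ∈ G' := by
  have hfin : {I | I ⊆ G ∧ PointedCone.hull ℝ I = PointedCone.hull ℝ G}.Finite :=
    hG.finite_subsets.subset fun _ h => h.1
  -- In a minimal generating subset no `g` lies in the cone of the others. Below, `g` is written
  -- through `G'`, and each element of `G'` used is written as `a x • g + y x` with `y x` in the
  -- cone of the others.
  obtain ⟨I, hI⟩ := hfin.exists_minimal ⟨G, subset_rfl, rfl⟩
  refine ⟨I, hI.prop.1, hI.prop.2, fun g hg => ?_⟩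
  have hIeq := hI.prop.2
  set C := PointedCone.hull ℝ G with hC
  have hI₀ : PointedCone.hull ℝ (I \ {g}) ≤ C := by
    rw [← hIeq]; exact Submodule.span_mono Set.sdiff_subset
  have hgC : g ∈ C := by rw [← hIeq]; exact PointedCone.subset_hull hg
  have hnot : g ∉ PointedCone.hull ℝ (I \ {g}) := by
    intro hmem
    have : I ⊆ I \ {g} := hI.le_of_le ⟨Set.sdiff_subset.trans hI.prop.1, ?_⟩ Set.sdiff_subset
    · exact (this hg).2 rfl
    · refine le_antisymm hI₀ ?_
      rw [← hIeq]
      refine Submodule.span_le.2 fun x hx => ?_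
      by_cases hxg : x = g
      · rw [hxg]; exact hmem
      · exact PointedCone.subset_hull ⟨hx, hxg⟩
  have hdec : ∀ x ∈ C, ∃ a : ℝ, 0 ≤ a ∧ ∃ y ∈ PointedCone.hull ℝ (I \ {g}), x = a • g + y := by
    intro x hx
    rw [← hIeq, ← Set.insert_sdiff_self_of_mem hg] at hx
    obtain ⟨a, y, hy, rfl⟩ := Submodule.mem_span_insert.1 hx
    exact ⟨a, a.2, y, hy, rfl⟩
  have hgC' := hgC
  rw [hGG'] at hgC'
  obtain ⟨c, hcG', hc0, hcg⟩ := PointedCone.mem_hull_set.1 hgC'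
  have hsupp : ∀ x ∈ c.support, x ∈ C := fun x hx => by
    rw [hGG']; exact PointedCone.subset_hull (hcG' hx)
  choose! a ha y hy hxy using fun x hx => hdec x (hsupp x hx)
  have hsum : g = (∑ x ∈ c.support, c x * a x) • g + ∑ x ∈ c.support, c x • y x := by
    conv_lhs => rw [← hcg, Finsupp.sum]
    rw [Finset.sum_smul, ← Finset.sum_add_distrib]
    refine Finset.sum_congr rfl fun x hx => ?_
    simpa only [smul_add, smul_smul] using congrArg (fun t => c x • t) (hxy x hx)
  set α := ∑ x ∈ c.support, c x * a x with hα
  have hyC : ∀ x ∈ c.support, c x • y x ∈ PointedCone.hull ℝ (I \ {g}) := fun x hx =>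
    PointedCone.smul_mem _ (hc0 x) (hy x hx)
  have hα1 : 1 ≤ α := by
    by_contra! hlt
    refine hnot ?_
    have h1 : (1 - α) • g = ∑ x ∈ c.support, c x • y x := by
      rw [sub_smul, one_smul, sub_eq_iff_eq_add']; exact hsum
    have h2 : g = (1 - α)⁻¹ • ∑ x ∈ c.support, c x • y x := by
      rw [← h1, smul_smul, inv_mul_cancel₀ (by linarith), one_smul]
    have h3 := PointedCone.smul_mem _ (inv_nonneg.2 (by linarith : 0 ≤ 1 - α)) (sum_mem hyC)
    rwa [← h2] at h3
  -- Since `α ≥ 1`, the relation `0 = (α - 1) g + ∑ c x • y x` has all terms in a salient cone, so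
  -- each vanishes.
  have hzero : ∀ x ∈ c.support, c x • y x = 0 := by
    classical
    intro x hx
    refine hsal _ (hI₀ (hyC x hx)) ?_
    have h1 : -(c x • y x) = (α - 1) • g + ∑ x ∈ c.support.erase x, c x • y x := by
      rw [← Finset.add_sum_erase _ _ hx] at hsum
      have h3 : (α - 1) • g = α • g - g := by module
      rw [h3]
      nth_rw 2 [hsum]
      abel
    rw [h1]
    exact add_mem (PointedCone.smul_mem _ (by linarith) hgC)
      (sum_mem fun x hx => hI₀ (hyC x (Finset.mem_of_mem_erase hx)))
  obtain ⟨x, hx, hpos⟩ : ∃ x ∈ c.support, 0 < c x * a x := by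
    by_contra! hcon
    have := Finset.sum_nonpos hcon
    linarith
  have hcx : c x ≠ 0 := by rintro h; simp [h] at hpos
  have hyx := (smul_eq_zero.1 (hzero x hx)).resolve_left hcx
  have hxg := hxy x hx
  rw [hyx, add_zero] at hxg
  refine ⟨a x, ?_, ?_⟩
  · refine lt_of_le_of_ne (ha x hx) ?_
    rintro h; simp [← h] at hpos
  · rw [← hxg]; exact hcG' hx

theorem hull_image {E Q : Type*} [AddCommGroup E] [Module ℝ E] [AddCommGroup Q] [Module ℝ Q]
    (q : E →ₗ[ℝ] Q) (G : Set E) :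
    PointedCone.hull ℝ (q '' G) = (PointedCone.hull ℝ G).map q := by
  unfold PointedCone.hull PointedCone.map
  rw [Submodule.map_span]
  rfl

/-- The standing assumptions on the set of lattice points of a full-dimensional polytope. -/
structure IsLatticePointSet (V : Set (Fin d → ℤ)) : Prop where
  finite : V.Finite
  nonempty : V.Nonempty
  separates : ∀ u ∈ V, Separates (shift V u)
  mem_of_mem_convexHull : ∀ z, toReal z ∈ convexHull ℝ (toReal '' V) → z ∈ V

/-- The rational tangent cone of `V` at `u` is generated by the edge vectors. -/
theorem IsLatticePointSet.mem_hull_edgeVectors {V : Set (Fin d → ℤ)} (hV : IsLatticePointSet V)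
    {u : Fin d → ℤ} (hu : IsVertex V u) {x : Fin d → ℝ}
    (hx : x ∈ dualCone (facetVectors (shift V u))) :
    x ∈ PointedCone.hull ℝ (toReal '' edgeVectors (shift V u)) :=
  mem_hull_extremeVectors (finite_extremeVectors (finite_shift hV.finite u) (hV.separates u hu.1))
    (separates_facetVectors (finite_shift hV.finite u) (hV.separates u hu.1) hu.2) hx

theorem IsLatticePointSet.finite_edgeVectors {V : Set (Fin d → ℤ)} (hV : IsLatticePointSet V)
    {u : Fin d → ℤ} (hu : IsVertex V u) : (edgeVectors (shift V u)).Finite :=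
  finite_extremeVectors
    (finite_extremeVectors (finite_shift hV.finite u) (hV.separates u hu.1))
    (separates_facetVectors (finite_shift hV.finite u) (hV.separates u hu.1) hu.2)

theorem hull_edgeVectors_le (Z : Set (Fin d → ℤ)) :
    PointedCone.hull ℝ (toReal '' edgeVectors Z) ≤ dualCone (facetVectors Z) :=
  Submodule.span_le.2 (by rintro _ ⟨w, hw, rfl⟩; exact hw.mem)

theorem IsLatticePointSet.salient {V : Set (Fin d → ℤ)} (hV : IsLatticePointSet V)
    {u : Fin d → ℤ} (hu : IsVertex V u) {x : Fin d → ℝ}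
    (hx : x ∈ dualCone (facetVectors (shift V u)))
    (hx' : -x ∈ dualCone (facetVectors (shift V u))) : x = 0 :=
  (separates_facetVectors (finite_shift hV.finite u) (hV.separates u hu.1) hu.2).salient hx hx'

theorem IsLatticePointSet.add_mem_of_mem_edgeVectors {V : Set (Fin d → ℤ)}
    (hV : IsLatticePointSet V) {u : Fin d → ℤ} (hu : IsVertex V u) {w : Fin d → ℤ}
    (hw : w ∈ edgeVectors (shift V u)) : u + w ∈ V := by
  obtain ⟨n, hn, hnw⟩ := exists_pos_smul_of_mem_edgeVectors (finite_shift hV.finite u)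
    (hV.separates u hu.1) hu.2 hw
  refine hV.mem_of_mem_convexHull _ ?_
  have hn' : (1 : ℝ) ≤ n := by exact_mod_cast hn
  have e : toReal (u + w) = (1 - (n : ℝ)⁻¹) • toReal u + (n : ℝ)⁻¹ • toReal (u + n • w) := by
    rw [toReal_add, toReal_add, toReal_smul, smul_add, smul_smul, inv_mul_cancel₀ (by linarith)]
    module
  rw [e]
  exact convex_convexHull ℝ (toReal '' V) (subset_convexHull ℝ _ (Set.mem_image_of_mem _ hu.1))
    (subset_convexHull ℝ _ (Set.mem_image_of_mem _ hnw)) (sub_nonneg.2 (inv_le_one_of_one_le₀ hn'))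
    (inv_nonneg.2 (by linarith)) (by ring)

/-- Tangent cones at two vertices on a line agree modulo that line. -/
theorem IsLatticePointSet.exists_add_smul_mem {V : Set (Fin d → ℤ)} (hV : IsLatticePointSet V)
    {u w : Fin d → ℤ} {l : ℤ} (hu : IsVertex V (u + l • w)) {x : Fin d → ℝ}
    (hx : x ∈ dualCone (facetVectors (shift V (u + l • w)))) :
    ∃ μ : ℝ, x + μ • toReal w ∈ dualCone (facetVectors (shift V u)) := by
  have h := hV.mem_hull_edgeVectors hu hx
  clear hx
  induction h using Submodule.span_induction with
  | mem x hx =>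
    obtain ⟨e, he, rfl⟩ := hx
    obtain ⟨n, hn, hne⟩ := exists_pos_smul_of_mem_edgeVectors (finite_shift hV.finite _)
      (hV.separates _ hu.1) hu.2 he
    have hn' : (0 : ℝ) < n := by exact_mod_cast hn
    have h1 : n • e + l • w ∈ shift V u := by
      rw [mem_shift] at hne ⊢
      rwa [add_comm (n • e), ← add_assoc]
    refine ⟨(n : ℝ)⁻¹ * l, ?_⟩
    have := PointedCone.smul_mem _ (inv_nonneg.2 hn'.le) (mem_dualCone_facetVectors h1)
    rwa [toReal_add, toReal_smul, toReal_smul, smul_add, smul_smul, smul_smul,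
      inv_mul_cancel₀ hn'.ne', one_smul] at this
  | zero => exact ⟨0, by simp⟩
  | add x y hx hy ihx ihy =>
    obtain ⟨μ, h1⟩ := ihx
    obtain ⟨ν, h2⟩ := ihy
    refine ⟨μ + ν, ?_⟩
    have := add_mem h1 h2
    rwa [show x + μ • toReal w + (y + ν • toReal w) = x + y + (μ + ν) • toReal w by module] at this
  | smul a x hx ih =>
    obtain ⟨μ, h1⟩ := ih
    refine ⟨a * μ, ?_⟩
    have := PointedCone.smul_mem _ a.2 h1
    rw [smul_add, smul_smul] at this
    exact this

/-- A decomposition of a multiple of `w` in the tangent cone at the far end becomes, after adding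
multiples of `w`, one in the tangent cone at `u`, where `w` is extreme. -/
theorem IsLatticePointSet.neg_mem_edgeVectors {V : Set (Fin d → ℤ)} (hV : IsLatticePointSet V)
    {u w : Fin d → ℤ} {l : ℤ} (hl : 0 < l) (hu : IsVertex V u) (hu' : IsVertex V (u + l • w))
    (hw : w ∈ edgeVectors (shift V u)) : -w ∈ edgeVectors (shift V (u + l • w)) := by
  have hspan : Submodule.span ℝ {toReal (-w)} = Submodule.span ℝ {toReal w} := by
    rw [toReal_neg, ← Set.neg_singleton, Submodule.span_neg]
  have hl' : (0 : ℝ) < l := by exact_mod_cast hl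
  refine ⟨by rw [gcd_neg]; exact hw.gcd_eq, ?_, fun x hx y hy hxy => ?_⟩
  · have h1 : -(l • w) ∈ shift V (u + l • w) := by
      rw [mem_shift]; simpa using hu.1
    have := PointedCone.smul_mem _ (inv_nonneg.2 hl'.le) (mem_dualCone_facetVectors h1)
    rwa [← smul_neg, toReal_smul, smul_smul, inv_mul_cancel₀ hl'.ne', one_smul] at this
  · rw [hspan] at hxy ⊢
    have hself := Submodule.mem_span_singleton_self (R := ℝ) (toReal w)
    obtain ⟨μ, h1⟩ := hV.exists_add_smul_mem hu' hx
    obtain ⟨ν, h2⟩ := hV.exists_add_smul_mem hu' hy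
    have h3 := hw.mem_span_left _ h1 _ h2 (by
      rw [show x + μ • toReal w + (y + ν • toReal w) = x + y + (μ + ν) • toReal w by module]
      exact Submodule.add_mem _ hxy (Submodule.smul_mem _ _ hself))
    exact (Submodule.add_mem_iff_left _ (Submodule.smul_mem _ _ hself)).1 h3

/-- The edge vectors at a neighbor of `u` that span a two-dimensional face together with the
connecting edge `w` and an edge at `u`. -/
def adjacentVectors (V : Set (Fin d → ℤ)) (u w : Fin d → ℤ) (l : ℤ) : Set (Fin d → ℤ) :=
  {e' | e' ∈ edgeVectors (shift V (u + l • w)) ∧ ∃ e ∈ edgeVectors (shift V u),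
    toReal e ∉ Submodule.span ℝ {toReal w} ∧
      ∃ a μ : ℝ, 0 < a ∧ toReal e' = a • toReal e + μ • toReal w}

/-- Modulo `w` both tangent cones have the same image, which is salient because `w` is extreme. Its
common generators lift to edges at both ends, and the nonzero ones give adjacent vectors. A vector
orthogonal to `w` and to these kills the whole image, hence `V - u`. -/
theorem IsLatticePointSet.separates_insert_adjacentVectors {V : Set (Fin d → ℤ)}
    (hV : IsLatticePointSet V) {u w : Fin d → ℤ} {l : ℤ} (hu : IsVertex V u)
    (hu' : IsVertex V (u + l • w)) (hw : w ∈ edgeVectors (shift V u)) :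
    Separates (insert (-w) (adjacentVectors V u w l)) := by
  have hback : u + l • w + (-l) • w = u := by simp
  let q := (Submodule.span ℝ {toReal w}).mkQ
  have hq : ∀ x, q x = 0 ↔ x ∈ Submodule.span ℝ {toReal w} := fun x =>
    Submodule.Quotient.mk_eq_zero _
  have hqw : q (toReal w) = 0 := (hq _).2 (Submodule.mem_span_singleton_self _)
  have hhull : ∀ G : Set (Fin d → ℝ), PointedCone.hull ℝ (q '' G) =
      (PointedCone.hull ℝ G).map q := fun G => hull_image q G
  have hincl : ∀ (v : Fin d → ℤ) (k : ℤ), IsVertex V v → IsVertex V (v + k • w) →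
      PointedCone.hull ℝ (q '' (toReal '' edgeVectors (shift V (v + k • w)))) ≤
        PointedCone.hull ℝ (q '' (toReal '' edgeVectors (shift V v))) := by
    intro v k hv hv'
    rw [hhull, hhull]
    rintro _ ⟨x, hx, rfl⟩
    obtain ⟨μ, h1⟩ := hV.exists_add_smul_mem hv' (hull_edgeVectors_le _ hx)
    refine PointedCone.mem_map.2 ⟨_, hV.mem_hull_edgeVectors hv h1, ?_⟩
    rw [map_add, map_smul, hqw, smul_zero, add_zero]
    rfl
  obtain ⟨I, hIG, hI, hIgen⟩ := exists_common_generators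
    (G := q '' (toReal '' edgeVectors (shift V u)))
    (G' := q '' (toReal '' edgeVectors (shift V (u + l • w))))
    (((hV.finite_edgeVectors hu).image _).image _)
    (le_antisymm (by
      have := hincl (u + l • w) (-l) hu' (by rwa [hback])
      rwa [hback] at this) (hincl u l hu hu'))
    (by
      intro x hx hx'
      rw [hhull] at hx hx'
      obtain ⟨t, ht, rfl⟩ := PointedCone.mem_map.1 hx
      obtain ⟨t', ht', h⟩ := PointedCone.mem_map.1 hx'
      refine (hq _).2 (hw.mem_span_left t (hull_edgeVectors_le _ ht) t'
        (hull_edgeVectors_le _ ht') ((hq _).1 ?_))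
      rw [map_add, h, add_neg_cancel])
  intro x hx
  have hxw : toReal w ⬝ᵥ x = 0 := by
    have := hx _ (Or.inl rfl)
    rwa [toReal_neg, neg_dotProduct, neg_eq_zero] at this
  let f : (Fin d → ℝ) →ₗ[ℝ] ℝ := dotProductEquiv ℝ (Fin d) x
  have hf : ∀ y, f y = y ⬝ᵥ x := fun y => by
    rw [dotProduct_comm]; rfl
  let g := (Submodule.span ℝ {toReal w}).liftQ f (by
    rw [Submodule.span_le]
    rintro _ rfl
    simpa [hf] using hxw)
  have hg : ∀ y, g (q y) = y ⬝ᵥ x := fun y => by rw [← hf]; rfl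
  have hgI : ∀ y ∈ I, g y = 0 := by
    intro y hy
    obtain ⟨a, ha, _, ⟨e', he', rfl⟩, hay⟩ := hIgen y hy
    obtain ⟨_, ⟨e, he, rfl⟩, rfl⟩ := hIG hy
    by_cases hqe : q (toReal e) = 0
    · rw [hqe, map_zero]
    · have h1 : toReal e' - a • toReal e ∈ Submodule.span ℝ {toReal w} := by
        rw [← hq, map_sub, map_smul, hay, sub_self]
      obtain ⟨μ, hμ⟩ := Submodule.mem_span_singleton.1 h1
      have h2 := hx e' (Or.inr ⟨he', e, he, fun h => hqe ((hq _).2 h), a, μ, ha, by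
        rw [hμ]; abel⟩)
      rw [← hg, hay, map_smul, smul_eq_mul] at h2
      exact (mul_eq_zero.1 h2).resolve_left ha.ne'
  have hgC : ∀ y ∈ PointedCone.hull ℝ I, g y = 0 := by
    intro y hy
    have : PointedCone.hull ℝ I ≤ (PointedCone.ofSubmodule (LinearMap.ker g)) :=
      Submodule.span_le.2 fun y hy => hgI y hy
    exact this hy
  refine hV.separates u hu.1 x fun z hz => ?_
  rw [← hg]
  refine hgC _ ?_
  rw [hI, hhull]
  exact PointedCone.mem_map.2 ⟨_, hV.mem_hull_edgeVectors hu (mem_dualCone_facetVectors hz), rfl⟩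

/-! ### Lattice triangles and the bounds for one step along an edge -/

/-- A lattice triangle with few lattice points has small index in its plane. -/
theorem one_le_of_card_triangle {e₁ e₂ p : Fin d → ℤ} {s t : ℝ}
    (hli : ∀ α β : ℝ, α • toReal e₁ + β • toReal e₂ = 0 → β = 0)
    (hp : toReal p = s • toReal e₁ + t • toReal e₂) (ht : t ≠ 0) {S : Finset (Fin d → ℤ)}
    (hS : ∀ (z : Fin d → ℤ) (α β : ℝ), 0 ≤ α → 0 ≤ β → α + β ≤ 1 →
      toReal z = α • toReal e₁ + β • toReal e₂ → z ∈ S) :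
    1 ≤ 2 * S.card * |t| := by
  wlog htpos : 0 < t generalizing p s t
  · have := this (p := -p) (s := -s) (t := -t) (by rw [toReal_neg, hp]; module)
      (neg_ne_zero.2 ht) (by
        have := lt_of_le_of_ne (not_lt.1 htpos) ht
        linarith)
    rwa [abs_neg] at this
  rw [abs_of_pos htpos]
  by_contra! hlt
  -- Pigeonhole: `j p` reduced modulo `e₁` lies in the parallelogram of `e₁`, `e₂` at height `j t <
  -- 1/2`. It or its reflection, at height `1 - j t > 1/2`, lies in the triangle, and different `j`
  -- give different heights: one point too many.
  have hex : ∀ j ∈ Finset.range (S.card + 1), ∃ z ∈ S, ∃ α β : ℝ,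
      toReal z = α • toReal e₁ + β • toReal e₂ ∧ (β = j * t ∨ β = 1 - j * t) := by
    intro j hj
    have hj' : (j : ℝ) ≤ S.card := by exact_mod_cast Nat.lt_succ_iff.1 (Finset.mem_range.1 hj)
    have hjt : j * t < 1 / 2 := by nlinarith
    have hjt0 : 0 ≤ j * t := by positivity
    have hf0 := Int.fract_nonneg (j * s)
    have hf1 := (Int.fract_lt_one (j * s)).le
    have hz : toReal ((j : ℤ) • p - ⌊j * s⌋ • e₁) =
        Int.fract (j * s) • toReal e₁ + (j * t) • toReal e₂ := by
      rw [toReal_sub, toReal_smul, toReal_smul, hp, Int.fract]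
      push_cast
      module
    by_cases h : Int.fract (j * s) + j * t ≤ 1
    · exact ⟨_, hS _ _ _ hf0 hjt0 h hz, _, _, hz, Or.inl rfl⟩
    · have hz' : toReal (e₁ + e₂ - ((j : ℤ) • p - ⌊j * s⌋ • e₁)) =
          (1 - Int.fract (j * s)) • toReal e₁ + (1 - j * t) • toReal e₂ := by
        rw [toReal_sub, toReal_add, hz]
        module
      exact ⟨_, hS _ _ _ (by linarith) (by linarith) (by linarith) hz', _, _, hz', Or.inr rfl⟩
  choose! F hFS a b hF hb using hex
  have hinj : Set.InjOn F (Finset.range (S.card + 1)) := by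
    intro j hj k hk hjk
    have h1 : b j = b k := by
      have h2 := hF j hj
      rw [hjk, hF k hk] at h2
      have := hli (a k - a j) (b k - b j) (by
        rw [sub_smul, sub_smul, ← sub_eq_zero.2 h2]; abel)
      linarith
    have hlt' : ∀ i ∈ Finset.range (S.card + 1), (i : ℝ) * t < 1 / 2 := fun i hi => by
      have : (i : ℝ) ≤ S.card := by exact_mod_cast Nat.lt_succ_iff.1 (Finset.mem_range.1 hi)
      nlinarith
    have h3 := hlt' j hj
    have h4 := hlt' k hk
    have h5 : (j : ℝ) * t = k * t := by
      rcases hb j hj with h | h <;> rcases hb k hk with h' | h' <;> linarith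
    exact_mod_cast mul_right_cancel₀ htpos.ne' h5
  have := Finset.card_le_card_of_injOn F hFS hinj
  simp at this

theorem IsLatticePointSet.one_le_of_triangle {V : Set (Fin d → ℤ)} (hV : IsLatticePointSet V)
    {u e₁ e₂ p : Fin d → ℤ} (hu : u ∈ V) (h₁ : u + e₁ ∈ V) (h₂ : u + e₂ ∈ V) {s t : ℝ}
    (hli : ∀ α β : ℝ, α • toReal e₁ + β • toReal e₂ = 0 → β = 0)
    (hp : toReal p = s • toReal e₁ + t • toReal e₂) (ht : t ≠ 0) :
    1 ≤ 2 * V.ncard * |t| := by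
  classical
  have hcard : (finite_shift hV.finite u).toFinset.card ≤ V.ncard := by
    rw [Set.ncard_eq_toFinset_card _ hV.finite]
    refine Finset.card_le_card_of_injOn (fun z => u + z) (fun z hz => ?_)
      (add_right_injective u).injOn
    simpa [shift] using hz
  refine (one_le_of_card_triangle hli hp ht (S := (finite_shift hV.finite u).toFinset) ?_).trans ?_
  · intro z α β hα hβ hαβ hz
    rw [Set.Finite.mem_toFinset, mem_shift]
    refine hV.mem_of_mem_convexHull _ ?_
    have e : toReal (u + z) = (1 - α - β) • toReal u + α • toReal (u + e₁) +
        β • toReal (u + e₂) := by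
      simp only [toReal_add, hz]
      module
    rw [e]
    have hc := convex_convexHull ℝ (toReal '' V)
    have m := fun v (hv : v ∈ V) => subset_convexHull ℝ _ (Set.mem_image_of_mem toReal hv)
    have := hc.sum_mem (t := Finset.univ) (w := ![1 - α - β, α, β])
      (z := ![toReal u, toReal (u + e₁), toReal (u + e₂)])
      (by intro i _; fin_cases i <;> simp <;> linarith)
      (by simp [Fin.sum_univ_three]; ring)
      (by intro i _; fin_cases i; exacts [m _ hu, m _ h₁, m _ h₂])
    simpa [Fin.sum_univ_three] using this
  · gcongr

theorem IsLatticePointSet.le_ncard_of_edge {V : Set (Fin d → ℤ)} (hV : IsLatticePointSet V)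
    {u w : Fin d → ℤ} {l : ℤ} (hl : 0 < l) (hw : w ≠ 0) (hu : u ∈ V) (hu' : u + l • w ∈ V) :
    l ≤ V.ncard := by
  have hl' : (0 : ℝ) < l := by exact_mod_cast hl
  have hmaps : ∀ j ∈ Finset.Icc 1 l, u + j • w ∈ (hV.finite.toFinset : Set (Fin d → ℤ)) := by
    intro j hj
    rw [Finset.mem_Icc] at hj
    rw [Set.Finite.coe_toFinset]
    refine hV.mem_of_mem_convexHull _ ?_
    have h0 : (0 : ℝ) ≤ j := by exact_mod_cast zero_le_one.trans hj.1
    have h1 : (j : ℝ) ≤ l := by exact_mod_cast hj.2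
    have e : toReal (u + j • w) = (1 - (l : ℝ)⁻¹ * j) • toReal u +
        ((l : ℝ)⁻¹ * j) • toReal (u + l • w) := by
      simp only [toReal_add, toReal_smul, smul_add, smul_smul]
      rw [show (l : ℝ)⁻¹ * j * l = j by field_simp]
      module
    rw [e]
    refine convex_convexHull ℝ (toReal '' V) (subset_convexHull ℝ _ (Set.mem_image_of_mem _ hu))
      (subset_convexHull ℝ _ (Set.mem_image_of_mem _ hu')) (sub_nonneg.2 ?_) (by positivity)
      (by ring)
    rw [inv_mul_eq_div]
    exact (div_le_one hl').2 h1
  have := Finset.card_le_card_of_injOn (fun j : ℤ => u + j • w) hmaps fun j _ k _ h =>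
    smul_left_injective ℤ hw (add_left_cancel h)
  rw [Int.card_Icc, ← Set.ncard_eq_toFinset_card _ hV.finite] at this
  omega

/-- Two triangles with apex `u` are used. In the one with sides `l w` and `l w + e'`, the vector `e`
has second coefficient `1/a`. In the one with sides `e` and `l w + e'`, the vector `w` has second
coefficient `1/(l + μ)`; then `l ≤ V.ncard` bounds `μ`. -/
theorem IsLatticePointSet.bounds_of_adjacent {V : Set (Fin d → ℤ)} (hV : IsLatticePointSet V)
    {u w e e' : Fin d → ℤ} {l : ℤ} (hl : 0 < l) (hu : IsVertex V u) (hu' : IsVertex V (u + l • w))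
    (hw : w ∈ edgeVectors (shift V u)) (he : e ∈ edgeVectors (shift V u))
    (hew : toReal e ∉ Submodule.span ℝ {toReal w}) (he' : e' ∈ edgeVectors (shift V (u + l • w)))
    {a μ : ℝ} (ha : 0 < a) (h : toReal e' = a • toReal e + μ • toReal w) :
    a ≤ 2 * V.ncard ∧ |μ| ≤ 3 * V.ncard := by
  have hw0 := toReal_ne_zero (ne_zero_of_gcd hw.gcd_eq)
  have hl' : (0 : ℝ) < l := by exact_mod_cast hl
  have hli : ∀ α β : ℝ, α • toReal e + β • toReal w = 0 → α = 0 ∧ β = 0 := by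
    intro α β h0
    have hα : α = 0 := by
      by_contra hα
      refine hew ((Submodule.smul_mem_iff _ hα).1 ?_)
      rw [eq_neg_of_add_eq_zero_left h0]
      exact neg_mem (Submodule.smul_mem _ _ (Submodule.mem_span_singleton_self _))
    rw [hα, zero_smul, zero_add] at h0
    exact ⟨hα, (smul_eq_zero.1 h0).resolve_right hw0⟩
  have h1 := hV.add_mem_of_mem_edgeVectors hu he
  have h2 := hV.add_mem_of_mem_edgeVectors hu' he'
  rw [add_assoc] at h2
  have e2 : toReal (l • w + e') = a • toReal e + (l + μ) • toReal w := by
    rw [toReal_add, toReal_smul, h]; module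
  constructor
  · have := hV.one_le_of_triangle (e₁ := l • w) (e₂ := l • w + e') (p := e)
      (s := -(a⁻¹ * (l + μ) * (l : ℝ)⁻¹)) (t := a⁻¹) hu.1 hu'.1 h2
      (fun α β h0 => by
        rw [e2, toReal_smul] at h0
        have := (hli (β * a) (α * l + β * (l + μ)) (by rw [← h0]; module)).1
        exact (mul_eq_zero.1 this).resolve_right ha.ne')
      (by
        rw [e2, toReal_smul]
        have h3 : toReal e = (a⁻¹ * a) • toReal e := by
          rw [inv_mul_cancel₀ ha.ne', one_smul]
        have h4 : -(a⁻¹ * (l + μ) * (l : ℝ)⁻¹) * l = -(a⁻¹ * (l + μ)) := by field_simp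
        rw [smul_smul, h4]
        nth_rw 1 [h3]
        module)
      (by positivity)
    rw [abs_of_pos (by positivity), ← div_eq_mul_inv, le_div_iff₀ ha] at this
    linarith
  · have hlN : (l : ℝ) ≤ V.ncard := by
      exact_mod_cast hV.le_ncard_of_edge hl (ne_zero_of_gcd hw.gcd_eq) hu.1 hu'.1
    have hb : |l + μ| ≤ 2 * V.ncard := by
      by_cases h0 : (l + μ : ℝ) = 0
      · rw [h0]; simp
      have := hV.one_le_of_triangle (e₁ := e) (e₂ := l • w + e') (p := w)
        (s := -((l + μ)⁻¹ * a)) (t := (l + μ)⁻¹) hu.1 h1 h2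
        (fun α β h3 => by
          rw [e2] at h3
          have := (hli (α + β * a) (β * (l + μ)) (by rw [← h3]; module)).2
          exact (mul_eq_zero.1 this).resolve_right h0)
        (by
          rw [e2]
          have h3 : toReal w = ((l + μ)⁻¹ * (l + μ)) • toReal w := by
            rw [inv_mul_cancel₀ h0, one_smul]
          nth_rw 1 [h3]
          module)
        (inv_ne_zero h0)
      rw [abs_inv, ← div_eq_mul_inv, le_div_iff₀ (abs_pos.2 h0)] at this
      linarith
    rw [abs_le] at hb ⊢
    constructor <;> linarith

/-- Cramer's rule: each coefficient is a quotient of determinants of vectors from `E`, with a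
nonzero integer as denominator. -/
theorem exists_coeff_of_det_le {E : Set (Fin d → ℤ)} {K : ℕ}
    (hK : ∀ v : Fin d → Fin d → ℤ, (∀ i, v i ∈ E) → (Matrix.of v).det.natAbs ≤ K)
    {b : Fin d → Fin d → ℤ} (hb : ∀ i, b i ∈ E) (hdet : (Matrix.of b).det ≠ 0)
    {x : Fin d → ℤ} (hx : x ∈ E) :
    ∃ c : Fin d → ℝ, (∀ i, |c i| ≤ K) ∧ toReal x = ∑ i, c i • toReal (b i) := by
  have hD : ((Matrix.of b).det : ℝ) ≠ 0 := by exact_mod_cast hdet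
  refine ⟨fun i => ((Matrix.of b).det : ℝ)⁻¹ * ((Matrix.of b).transpose.cramer x i : ℤ),
    fun i => ?_, ?_⟩
  · beta_reduce
    rw [Matrix.cramer_transpose_apply]
    have h1 : ((Matrix.of b).updateRow i x).det.natAbs ≤ K := by
      have := hK (Function.update b i x) (fun j => by
        by_cases h : j = i
        · rw [h, Function.update_self]; exact hx
        · rw [Function.update_of_ne h]; exact hb j)
      exact this
    have h2 : (1 : ℝ) ≤ |((Matrix.of b).det : ℝ)| := by
      rw [← Int.cast_abs]; exact_mod_cast Int.one_le_abs hdet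
    have h3 : |(((Matrix.of b).updateRow i x).det : ℝ)| ≤ K := by
      rw [← Int.cast_abs, Int.abs_eq_natAbs]; exact_mod_cast h1
    rw [abs_mul, abs_inv]
    calc _ ≤ 1 * (K : ℝ) := by
            gcongr
            exact inv_le_one_of_one_le₀ h2
      _ = K := one_mul _
  · have h := Matrix.mulVec_cramer (Matrix.of b).transpose x
    rw [Matrix.det_transpose] at h
    ext j
    have hj := congrFun h j
    simp only [Matrix.mulVec, dotProduct, Matrix.transpose_apply, Matrix.of_apply, Pi.smul_apply,
      smul_eq_mul] at hj
    have hj' : ∑ i, (b i j : ℝ) * ((Matrix.of b).transpose.cramer x i : ℤ) =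
        (Matrix.of b).det * x j := by exact_mod_cast hj
    simp only [toReal_apply, Finset.sum_apply, Pi.smul_apply, smul_eq_mul]
    have : (x j : ℝ) = ((Matrix.of b).det : ℝ)⁻¹ * ((Matrix.of b).det * x j) := by
      field_simp
    rw [this, ← hj', Finset.mul_sum]
    exact Finset.sum_congr rfl fun i _ => by ring

/-- Passing to a neighboring vertex changes coordinates of edge vectors by a bounded factor. -/
theorem IsLatticePointSet.norm_edgeVectors_le {V : Set (Fin d → ℤ)} (hV : IsLatticePointSet V)
    {u w : Fin d → ℤ} {l : ℤ} (hl : 0 < l) (hu : IsVertex V u) (hu' : IsVertex V (u + l • w))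
    (hw : w ∈ edgeVectors (shift V u)) {K : ℕ}
    (hK : ∀ v : Fin d → Fin d → ℤ, (∀ i, v i ∈ edgeVectors (shift V (u + l • w))) →
      (Matrix.of v).det.natAbs ≤ K)
    (Φ : (Fin d → ℝ) →ₗ[ℝ] (Fin d → ℝ)) {R : ℝ}
    (hR : ∀ e ∈ edgeVectors (shift V u), ‖Φ (toReal e)‖ ≤ R) {x : Fin d → ℤ}
    (hx : x ∈ edgeVectors (shift V (u + l • w))) :
    ‖Φ (toReal x)‖ ≤ d * (K * (5 * V.ncard * R)) := by
  have hR0 : 0 ≤ R := (norm_nonneg _).trans (hR w hw)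
  have hV1 : (1 : ℝ) ≤ V.ncard := by
    exact_mod_cast (Set.ncard_pos hV.finite).2 hV.nonempty
  -- A basis of edges at the far end that are controlled directly; the `5` below is the sum of the
  -- bounds `2` for `a` and `3` for `μ`.
  obtain ⟨b, hb, hdet⟩ := exists_det_ne_zero_of_separates
    (hV.separates_insert_adjacentVectors hu hu' hw)
  have hbE : ∀ i, b i ∈ edgeVectors (shift V (u + l • w)) := fun i => by
    rcases hb i with h | h
    · rw [h]; exact hV.neg_mem_edgeVectors hl hu hu' hw
    · exact h.1
  have hbR : ∀ i, ‖Φ (toReal (b i))‖ ≤ 5 * V.ncard * R := fun i => by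
    rcases hb i with h | ⟨he', e, he, hew, a, μ, ha, hae⟩
    · rw [h, toReal_neg, map_neg, norm_neg]
      refine (hR w hw).trans (le_mul_of_one_le_left hR0 (by linarith))
    · obtain ⟨h1, h2⟩ := hV.bounds_of_adjacent hl hu hu' hw he hew he' ha hae
      rw [hae, map_add, map_smul, map_smul]
      calc _ ≤ ‖a • Φ (toReal e)‖ + ‖μ • Φ (toReal w)‖ := norm_add_le _ _
        _ = a * ‖Φ (toReal e)‖ + |μ| * ‖Φ (toReal w)‖ := by
          rw [norm_smul, norm_smul, Real.norm_of_nonneg ha.le, Real.norm_eq_abs]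
        _ ≤ (2 * V.ncard) * R + (3 * V.ncard) * R := by
          gcongr
          exacts [hR e he, hR w hw]
        _ = 5 * V.ncard * R := by ring
  obtain ⟨c, hc, hxc⟩ := exists_coeff_of_det_le hK hbE hdet hx
  rw [hxc, map_sum]
  refine (norm_sum_le _ _).trans ?_
  calc _ ≤ ∑ _i : Fin d, (K * (5 * V.ncard * R)) := by
        refine Finset.sum_le_sum fun i _ => ?_
        rw [map_smul, norm_smul, Real.norm_eq_abs]
        gcongr
        exacts [hc i, hbR i]
    _ = _ := by simp

/-! ### From polytopes to their lattice points -/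

/-- The lattice points of `P`. -/
def latticePoints (P : Set (Fin d → ℝ)) : Set (Fin d → ℤ) := {z | toReal z ∈ P}

theorem convexHull_latticePoints {P : Set (Fin d → ℝ)} (hP : IsLatticePolytope P) :
    convexHull ℝ (toReal '' latticePoints P) = P := by
  obtain ⟨V, rfl⟩ := hP
  refine le_antisymm (convexHull_min ?_ (convex_convexHull _ _)) (convexHull_mono ?_)
  · rintro _ ⟨z, hz, rfl⟩; exact hz
  · rintro _ ⟨z, hz, rfl⟩
    exact ⟨z, subset_convexHull _ _ ⟨z, hz, rfl⟩, rfl⟩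

theorem ncard_latticePoints (P : Set (Fin d → ℝ)) :
    (latticePoints P).ncard = (P ∩ intLattice d).ncard := by
  rw [← Set.ncard_image_of_injective _ toReal_injective]
  congr 1
  ext x
  constructor
  · rintro ⟨z, hz, rfl⟩; exact ⟨hz, z, rfl⟩
  · rintro ⟨hx, z, rfl⟩; exact ⟨z, hx, rfl⟩

theorem separates_shift_of_affineSpan {V : Set (Fin d → ℤ)}
    (hV : affineSpan ℝ (toReal '' V) = ⊤) (u : Fin d → ℤ) : Separates (shift V u) := by
  intro x hx
  let A := AffineSubspace.mk' (toReal u) (LinearMap.ker (dotProductEquiv ℝ (Fin d) x))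
  have hle : affineSpan ℝ (toReal '' V) ≤ A := by
    rw [affineSpan_le]
    rintro _ ⟨v, hv, rfl⟩
    have := hx (v - u) (by simpa [shift] using hv)
    rw [dotProduct_comm, toReal_sub] at this
    exact this
  rw [hV, top_le_iff] at hle
  have hdir := AffineSubspace.direction_mk' (toReal u)
    (LinearMap.ker (dotProductEquiv ℝ (Fin d) x))
  rw [show AffineSubspace.mk' (toReal u) (LinearMap.ker (dotProductEquiv ℝ (Fin d) x)) = ⊤ from hle,
    AffineSubspace.direction_top] at hdir
  have h0 := LinearMap.ker_eq_top.1 hdir.symm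
  simpa using h0

theorem isLatticePointSet_latticePoints {m N : ℕ} {P : Set (Fin d → ℝ)}
    (hP : P ∈ boundedGorensteinPolytopes d m N) : IsLatticePointSet (latticePoints P) := by
  obtain ⟨h1, h2, h3, -⟩ := hP
  rw [← ncard_latticePoints] at h3
  refine ⟨Set.finite_of_ncard_ne_zero (by omega), Set.nonempty_of_ncard_ne_zero (by omega),
    fun u _ => separates_shift_of_affineSpan ?_ u, fun z hz => ?_⟩
  · rw [← affineSpan_convexHull, convexHull_latticePoints h1, h2]
  · rwa [convexHull_latticePoints h1] at hz

theorem normalCone_eq_dualCone {P : Set (Fin d → ℝ)} (hP : IsLatticePolytope P) (u : Fin d → ℤ) :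
    normalCone P (toReal u) = dualCone (shift (latticePoints P) u) := by
  rw [normalCone, tangentCone, PointedCone.dual_hull]
  ext y
  rw [mem_dualCone]
  constructor
  · intro hy z hz
    have := hy ⟨toReal (u + z), hz, rfl⟩
    simpa using this
  · rintro hy _ ⟨x, hx, rfl⟩
    have hsub : P ⊆ {x | toReal u ⬝ᵥ y ≤ (dotProductEquiv ℝ (Fin d) y) x} := by
      conv_lhs => rw [← convexHull_latticePoints hP]
      refine convexHull_min ?_ (convex_halfSpace_ge (LinearMap.isLinear _) _)
      rintro _ ⟨v, hv, rfl⟩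
      have := hy (v - u) (by simpa [shift] using hv)
      rw [toReal_sub, sub_dotProduct, dotProduct_comm (toReal v)] at this
      exact sub_nonneg.1 this
    have h1 : toReal u ⬝ᵥ y ≤ y ⬝ᵥ x := hsub hx
    change 0 ≤ (x - toReal u) ⬝ᵥ y
    rw [sub_dotProduct, dotProduct_comm x]
    linarith

/-- The nib bounds determinants of facet vectors by `m * d ^ d`, and duality turns `K` into `d ! * K
^ d`. -/
theorem natAbs_det_edgeVectors_le {m N : ℕ} {P : Set (Fin d → ℝ)}
    (hP : P ∈ boundedGorensteinPolytopes d m N) {u : Fin d → ℤ}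
    (hu : IsVertex (latticePoints P) u) (v : Fin d → Fin d → ℤ)
    (hv : ∀ i, v i ∈ edgeVectors (shift (latticePoints P) u)) :
    (Matrix.of v).det.natAbs ≤ d ! * (m * d ^ d) ^ d := by
  have hV := isLatticePointSet_latticePoints hP
  have hZ := finite_shift hV.finite u
  have hs := hV.separates u hu.1
  have hext := hu.mem_extremePoints
  rw [convexHull_latticePoints hP.1] at hext
  have hm := (hP.2.2.2 _ hext).2
  rw [normalCone_eq_dualCone hP.1] at hm
  exact natAbs_det_le_of_dual (finite_extremeVectors hZ hs) (separates_facetVectors hZ hs hu.2)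
    (fun v hv => natAbs_det_le_of_multiplicity_le hm v fun i =>
      (hv i).toReal_mem_primitiveGenerators fun x h1 h2 => hs.salient h1 h2) v hv

theorem separates_edgeVectors {V : Set (Fin d → ℤ)} (hV : IsLatticePointSet V) {u : Fin d → ℤ}
    (hu : IsVertex V u) : Separates (edgeVectors (shift V u)) := by
  intro x hx
  refine hV.separates u hu.1 x fun z hz => ?_
  have h := hV.mem_hull_edgeVectors hu (mem_dualCone_facetVectors hz)
  have hle : PointedCone.hull ℝ (toReal '' edgeVectors (shift V u)) ≤
      PointedCone.ofSubmodule (LinearMap.ker (dotProductEquiv ℝ (Fin d) x)) :=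
    Submodule.span_le.2 (by
      rintro _ ⟨e, he, rfl⟩
      have := hx e he
      rw [dotProduct_comm] at this
      exact this)
  have : x ⬝ᵥ toReal z = 0 := hle h
  rwa [dotProduct_comm]

/-! ### Propagation through the vertex graph -/

/-- A set of vertices closed under passing to neighbors spans the whole polytope. -/
theorem IsLatticePointSet.subset_convexHull_of_closed {V : Set (Fin d → ℤ)}
    (hV : IsLatticePointSet V) {A : Set (Fin d → ℤ)} (hA : ∀ u ∈ A, IsVertex V u)
    (hne : A.Nonempty) (hclosed : ∀ u ∈ A, ∀ w ∈ edgeVectors (shift V u), ∀ l : ℤ, 0 < l →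
      IsVertex V (u + l • w) → u + l • w ∈ A) :
    toReal '' V ⊆ convexHull ℝ (toReal '' A) := by
  rintro _ ⟨p, hp, rfl⟩
  by_contra hcon
  have hAfin : A.Finite := hV.finite.subset fun u hu => (hA u hu).1
  obtain ⟨f, c, hf, hc⟩ := geometric_hahn_banach_point_closed (convex_convexHull ℝ _)
    ((hAfin.image toReal).isClosed_convexHull ℝ) hcon
  obtain ⟨u, hu, hmin⟩ := A.exists_min_image (fun u => f (toReal u)) hAfin hne
  have hpu : f (toReal p) < f (toReal u) :=
    hf.trans (hc _ (subset_convexHull ℝ _ (Set.mem_image_of_mem _ hu)))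
  -- As in the simplex method: `p - u` lies in the cone of the edges at `u` and `f` is negative on
  -- it, so some edge decreases `f` and leads to a neighbor below the minimum over `A`.
  obtain ⟨w, hw, hfw⟩ : ∃ w ∈ edgeVectors (shift V u), f (toReal w) < 0 := by
    by_contra! hall
    have hle : PointedCone.hull ℝ (toReal '' edgeVectors (shift V u)) ≤
        (PointedCone.positive ℝ ℝ).comap (f : (Fin d → ℝ) →ₗ[ℝ] ℝ) :=
      Submodule.span_le.2 (by rintro _ ⟨e, he, rfl⟩; exact hall e he)
    have h1 := hle (hV.mem_hull_edgeVectors (hA u hu) (mem_dualCone_facetVectors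
      (z := p - u) (by simpa [shift] using hp)))
    have h2 : 0 ≤ f (toReal (p - u)) := h1
    rw [toReal_sub, map_sub] at h2
    linarith
  obtain ⟨l, hl, hvert⟩ := exists_neighbor hV.finite (hA u hu) (hV.separates u (hA u hu).1) hw
  have h1 := hmin _ (hclosed u hu w hw l hl hvert)
  have hl' : (0 : ℝ) < l := by exact_mod_cast hl
  simp only [toReal_add, toReal_smul, map_add, map_smul, smul_eq_mul] at h1
  nlinarith

theorem exists_succ_subset_of_finite {α : Type*} {V : Set α} (hV : V.Finite) {A : ℕ → Set α}
    (hA : ∀ k, A k ⊆ V) (hmono : ∀ k, A k ⊆ A (k + 1)) :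
    ∃ k ≤ V.ncard, A (k + 1) ⊆ A k := by
  by_contra! hcon
  have h : ∀ k ≤ V.ncard + 1, k ≤ (A k).ncard := by
    intro k
    induction k with
    | zero => simp
    | succ k ih =>
      intro hk
      have h1 := ih (by omega)
      have h2 := Set.ncard_lt_ncard ((hmono k).ssubset_of_not_subset (hcon k (by omega)))
        (hV.subset (hA _))
      omega
  have h1 := h _ le_rfl
  have h2 := Set.ncard_le_ncard (hA (V.ncard + 1)) hV
  omega

/-- All points are bounded in coordinates in which the edge vectors at one vertex are bounded. -/
theorem IsLatticePointSet.norm_sub_le {V : Set (Fin d → ℤ)} (hV : IsLatticePointSet V) {K : ℕ}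
    (hK : ∀ u, IsVertex V u → ∀ v : Fin d → Fin d → ℤ, (∀ i, v i ∈ edgeVectors (shift V u)) →
      (Matrix.of v).det.natAbs ≤ K)
    (Φ : (Fin d → ℝ) →ₗ[ℝ] (Fin d → ℝ)) {R : ℝ} (hR0 : 0 ≤ R) {u₀ : Fin d → ℤ}
    (hu₀ : IsVertex V u₀) (hR : ∀ e ∈ edgeVectors (shift V u₀), ‖Φ (toReal e)‖ ≤ R) :
    ∀ v ∈ V, ‖Φ (toReal (v - u₀))‖ ≤
      R * (1 + V.ncard + d * (K * (5 * V.ncard))) ^ V.ncard := by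
  -- The growth factor of one step: `1 + V.ncard` covers the position of the vertex, since `l ≤
  -- V.ncard`, and the last summand covers its edge vectors.
  set c : ℝ := 1 + V.ncard + d * (K * (5 * V.ncard)) with hc
  have hc1 : 1 ≤ c := by
    have h1 : (0 : ℝ) ≤ V.ncard := by positivity
    have h2 : (0 : ℝ) ≤ d * (K * (5 * V.ncard)) := by positivity
    linarith
  let A : ℕ → Set (Fin d → ℤ) := fun k => {u | IsVertex V u ∧ ‖Φ (toReal (u - u₀))‖ ≤ R * c ^ k ∧
    ∀ e ∈ edgeVectors (shift V u), ‖Φ (toReal e)‖ ≤ R * c ^ k}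
  have hρ : ∀ j k : ℕ, j ≤ k → R * c ^ j ≤ R * c ^ k := fun j k hjk =>
    mul_le_mul_of_nonneg_left (pow_le_pow_right₀ hc1 hjk) hR0
  -- The increasing sets `A k` lie in `V`, so two consecutive ones agree for some `k ≤ V.ncard`.
  -- Neighbors of points of `A k` lie in `A (k + 1)`, so this `A k` is closed under neighbors.
  obtain ⟨k, hk, hsub⟩ := exists_succ_subset_of_finite hV.finite (A := A) (fun k u hu => hu.1.1)
    (fun k u hu => ⟨hu.1, hu.2.1.trans (hρ _ _ k.le_succ),
      fun e he => (hu.2.2 e he).trans (hρ _ _ k.le_succ)⟩)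
  have hclosed : ∀ u ∈ A k, ∀ w ∈ edgeVectors (shift V u), ∀ l : ℤ, 0 < l →
      IsVertex V (u + l • w) → u + l • w ∈ A k := by
    rintro u ⟨hu, h1, h2⟩ w hw l hl hu'
    have hr0 : 0 ≤ R * c ^ k := by positivity
    have hlV : (l : ℝ) ≤ V.ncard := by
      exact_mod_cast hV.le_ncard_of_edge hl (ne_zero_of_gcd hw.gcd_eq) hu.1 hu'.1
    have hl0 : (0 : ℝ) < l := by exact_mod_cast hl
    have hV0 : (0 : ℝ) ≤ V.ncard := by positivity
    have hD0 : (0 : ℝ) ≤ d * (K * (5 * V.ncard)) := by positivity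
    refine hsub ⟨hu', ?_, fun e he => ?_⟩
    · have e1 : toReal (u + l • w - u₀) = toReal (u - u₀) + (l : ℝ) • toReal w := by
        simp only [toReal_sub, toReal_add, toReal_smul]; abel
      rw [e1, map_add, map_smul]
      refine (norm_add_le _ _).trans ?_
      rw [norm_smul, Real.norm_of_nonneg hl0.le, pow_succ]
      calc _ ≤ R * c ^ k + V.ncard * (R * c ^ k) := by
            gcongr
            exact h2 w hw
        _ = (R * c ^ k) * (1 + V.ncard) := by ring
        _ ≤ (R * c ^ k) * c := by
            refine mul_le_mul_of_nonneg_left ?_ hr0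
            linarith
        _ = _ := by ring
    · refine (hV.norm_edgeVectors_le hl hu hu' hw (hK _ hu') Φ h2 he).trans ?_
      rw [pow_succ]
      calc _ = (R * c ^ k) * (d * (K * (5 * V.ncard))) := by ring
        _ ≤ (R * c ^ k) * c := by
            refine mul_le_mul_of_nonneg_left ?_ hr0
            linarith
        _ = _ := by ring
  have hne : u₀ ∈ A k := by
    refine ⟨hu₀, ?_, fun e he => (hR e he).trans ?_⟩
    · simp only [sub_self, toReal_zero, map_zero, norm_zero]; positivity
    · simpa using hρ 0 k (Nat.zero_le _)
  have hall := hV.subset_convexHull_of_closed (fun u hu => hu.1) ⟨u₀, hne⟩ hclosed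
  intro v hv
  have hball : convexHull ℝ (toReal '' A k) ⊆
      Φ ⁻¹' Metric.closedBall (Φ (toReal u₀)) (R * c ^ V.ncard) := by
    refine convexHull_min ?_ ((convex_closedBall _ _).linear_preimage Φ)
    rintro _ ⟨u, hu, rfl⟩
    rw [Set.mem_preimage, mem_closedBall_iff_norm, ← map_sub, ← toReal_sub]
    exact hu.2.1.trans (hρ _ _ hk)
  have := hball (hall ⟨v, hv, rfl⟩)
  rwa [Set.mem_preimage, mem_closedBall_iff_norm, ← map_sub, ← toReal_sub] at this

/-! ### Coordinates, codes and finiteness -/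

/-- The matrix with columns `b i`. -/
def basisMatrix (b : Fin d → Fin d → ℤ) : Matrix (Fin d) (Fin d) ℤ := (Matrix.of b).transpose

/-- Coordinates with respect to the columns of the basis matrix. -/
noncomputable def coords (b : Fin d → Fin d → ℤ) : (Fin d → ℝ) →ₗ[ℝ] (Fin d → ℝ) :=
  Matrix.toLin' ((basisMatrix b).map (Int.castRingHom ℝ))⁻¹

/-- The linear map with given coordinates. -/
noncomputable def uncoords (b : Fin d → Fin d → ℤ) : (Fin d → ℝ) →ₗ[ℝ] (Fin d → ℝ) :=
  Matrix.toLin' ((basisMatrix b).map (Int.castRingHom ℝ))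

theorem isUnit_det_basisMatrix {b : Fin d → Fin d → ℤ} (hb : (Matrix.of b).det ≠ 0) :
    IsUnit ((basisMatrix b).map (Int.castRingHom ℝ)).det := by
  rw [← RingHom.mapMatrix_apply, ← RingHom.map_det, basisMatrix, Matrix.det_transpose,
    isUnit_iff_ne_zero]
  simpa using hb

theorem coords_uncoords {b : Fin d → Fin d → ℤ} (hb : (Matrix.of b).det ≠ 0) (x : Fin d → ℝ) :
    coords b (uncoords b x) = x := by
  rw [coords, uncoords, Matrix.toLin'_apply, Matrix.toLin'_apply, Matrix.mulVec_mulVec,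
    Matrix.nonsing_inv_mul _ (isUnit_det_basisMatrix hb), Matrix.one_mulVec]

theorem uncoords_coords {b : Fin d → Fin d → ℤ} (hb : (Matrix.of b).det ≠ 0) (x : Fin d → ℝ) :
    uncoords b (coords b x) = x := by
  rw [coords, uncoords, Matrix.toLin'_apply, Matrix.toLin'_apply, Matrix.mulVec_mulVec,
    Matrix.mul_nonsing_inv _ (isUnit_det_basisMatrix hb), Matrix.one_mulVec]

theorem uncoords_apply (b : Fin d → Fin d → ℤ) (c : Fin d → ℝ) :
    uncoords b c = ∑ i, c i • toReal (b i) := by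
  ext j
  simp [uncoords, basisMatrix, Matrix.mulVec, dotProduct, mul_comm]

theorem uncoords_toReal (b : Fin d → Fin d → ℤ) (n : Fin d → ℤ) :
    ∃ z : Fin d → ℤ, uncoords b (toReal n) = toReal z := by
  refine ⟨∑ i, n i • b i, ?_⟩
  rw [uncoords_apply]
  ext j
  simp

theorem det_smul_coords_toReal {b : Fin d → Fin d → ℤ} (hb : (Matrix.of b).det ≠ 0)
    (z : Fin d → ℤ) :
    ((Matrix.of b).det : ℝ) • coords b (toReal z) =
      toReal ((basisMatrix b).adjugate.mulVec z) := by
  have h1 : uncoords b (toReal ((basisMatrix b).adjugate.mulVec z)) =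
      ((Matrix.of b).det : ℝ) • toReal z := by
    have h2 : (basisMatrix b).mulVec ((basisMatrix b).adjugate.mulVec z) =
        (Matrix.of b).det • z := by
      rw [Matrix.mulVec_mulVec, Matrix.mul_adjugate, Matrix.smul_mulVec, Matrix.one_mulVec,
        basisMatrix, Matrix.det_transpose]
    rw [← toReal_smul, ← h2]
    generalize (basisMatrix b).adjugate.mulVec z = y
    ext j
    simp [uncoords, Matrix.mulVec, dotProduct]
  rw [← map_smul, ← h1, coords_uncoords hb]

/-- `c` records, up to integral equivalence, the polytope `P`: the small elements of the lattice
and the lattice points of `P`, in the coordinates given by a basis. -/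
def HasCode (ρ : ℝ) (P : Set (Fin d → ℝ)) (c : Set (Fin d → ℝ) × Set (Fin d → ℝ)) : Prop :=
  ∃ (u : Fin d → ℤ) (b : Fin d → Fin d → ℤ), (Matrix.of b).det ≠ 0 ∧
    c.1 = {x | ‖x‖ ≤ ρ ∧ ∃ z : Fin d → ℤ, x = coords b (toReal z)} ∧
    c.2 = (fun z => coords b (toReal (z - u))) '' latticePoints P

/-- The coordinate lattice contains the standard lattice, so subtracting integer parts moves any
element into the unit cube. With `ρ ≥ 1`, its elements of norm at most `ρ` therefore determine it.
-/
theorem exists_coords_eq {ρ : ℝ} (hρ : 1 ≤ ρ) {b b' : Fin d → Fin d → ℤ}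
    (hb : (Matrix.of b).det ≠ 0) (hb' : (Matrix.of b').det ≠ 0)
    (h : {x | ‖x‖ ≤ ρ ∧ ∃ z : Fin d → ℤ, x = coords b (toReal z)} ⊆
      {x | ‖x‖ ≤ ρ ∧ ∃ z : Fin d → ℤ, x = coords b' (toReal z)}) (z : Fin d → ℤ) :
    ∃ z' : Fin d → ℤ, uncoords b' (coords b (toReal z)) = toReal z' := by
  set x := coords b (toReal z) with hx
  let n : Fin d → ℤ := fun i => ⌊x i⌋
  obtain ⟨y, hy⟩ := uncoords_toReal b n
  obtain ⟨y', hy'⟩ := uncoords_toReal b' n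
  have h1 : x - toReal n = coords b (toReal (z - y)) := by
    rw [toReal_sub, map_sub, ← hy, coords_uncoords hb]
  have h2 : ‖x - toReal n‖ ≤ ρ := by
    refine le_trans ((pi_norm_le_iff_of_nonneg zero_le_one).2 fun i => ?_) hρ
    rw [Pi.sub_apply, toReal_apply, Real.norm_of_nonneg (sub_nonneg.2 (Int.floor_le _))]
    linarith [Int.lt_floor_add_one (x i)]
  obtain ⟨-, z₁, hz₁⟩ := h ⟨h2, _, h1⟩
  refine ⟨z₁ + y', ?_⟩
  rw [toReal_add, ← hy', ← uncoords_coords hb' (toReal z₁), ← hz₁, ← map_add]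
  simp

/-- The equivalence sends a point to the one with the same coordinates relative to the other vertex
and basis. The first component of the code matches the lattices, the second the lattice points of
the polytopes. -/
theorem integrallyEquivalent_of_hasCode {ρ : ℝ} (hρ : 1 ≤ ρ) {P P' : Set (Fin d → ℝ)}
    (hP : IsLatticePolytope P) (hP' : IsLatticePolytope P') (hs : affineSpan ℝ P = ⊤)
    (hs' : affineSpan ℝ P' = ⊤) {c : Set (Fin d → ℝ) × Set (Fin d → ℝ)} (hc : HasCode ρ P c)
    (hc' : HasCode ρ P' c) : IntegrallyEquivalent P P' := by
  obtain ⟨u, b, hb, h1, h2⟩ := hc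
  obtain ⟨u', b', hb', h1', h2'⟩ := hc'
  rw [h1] at h1'
  rw [h2] at h2'
  let f : (Fin d → ℝ) →ᵃ[ℝ] (Fin d → ℝ) :=
    (uncoords b' ∘ₗ coords b).toAffineMap + AffineMap.const ℝ _
      (toReal u' - uncoords b' (coords b (toReal u)))
  have hf : ∀ x, f x = uncoords b' (coords b (x - toReal u)) + toReal u' := fun x => by
    change uncoords b' (coords b x) + (toReal u' - uncoords b' (coords b (toReal u))) = _
    rw [map_sub, map_sub]
    abel
  refine ⟨f, ?_, ?_⟩
  · rw [hs, hs', AffineSubspace.top_coe, Set.inter_univ]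
    refine ⟨?_, ?_, ?_⟩
    · rintro _ ⟨z, rfl⟩
      obtain ⟨z', hz'⟩ := exists_coords_eq hρ hb hb' h1'.subset (z - u)
      exact ⟨z' + u', by rw [hf, ← toReal_sub, hz', toReal_add]⟩
    · intro x _ y _ hxy
      rw [hf, hf] at hxy
      have h3 := congrArg (coords b') (add_right_cancel hxy)
      rw [coords_uncoords hb', coords_uncoords hb'] at h3
      have h4 := congrArg (uncoords b) h3
      rw [uncoords_coords hb, uncoords_coords hb] at h4
      exact sub_left_injective h4
    · rintro _ ⟨z, rfl⟩
      obtain ⟨z', hz'⟩ := exists_coords_eq hρ hb' hb h1'.symm.subset (z - u')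
      refine ⟨toReal (z' + u), ⟨_, rfl⟩, ?_⟩
      rw [hf, toReal_add, add_sub_cancel_right, ← hz', coords_uncoords hb, uncoords_coords hb',
        toReal_sub, sub_add_cancel]
  · rw [← convexHull_latticePoints hP, ← convexHull_latticePoints hP', AffineMap.image_convexHull]
    congr 1
    ext x
    constructor
    · rintro ⟨_, ⟨z, hz, rfl⟩, rfl⟩
      have : coords b (toReal (z - u)) ∈ (fun z => coords b' (toReal (z - u'))) ''
          latticePoints P' := h2' ▸ ⟨z, hz, rfl⟩
      obtain ⟨z', hz', h3⟩ := this
      refine ⟨z', hz', ?_⟩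
      rw [hf, ← toReal_sub, ← h3]
      simp only [uncoords_coords hb', toReal_sub, sub_add_cancel]
    · rintro ⟨z', hz', rfl⟩
      have : coords b' (toReal (z' - u')) ∈ (fun z => coords b (toReal (z - u))) ''
          latticePoints P := h2'.symm ▸ ⟨z', hz', rfl⟩
      obtain ⟨z, hz, h3⟩ := this
      refine ⟨toReal z, ⟨z, hz, rfl⟩, ?_⟩
      simp only at h3
      rw [hf, ← toReal_sub, h3]
      simp only [uncoords_coords hb', toReal_sub, sub_add_cancel]

/-- Bounded vectors with bounded denominator. -/
def boundedFractions (d : ℕ) (ρ : ℝ) (K : ℕ) : Set (Fin d → ℝ) :=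
  {x | ‖x‖ ≤ ρ ∧ ∃ D : ℤ, D ≠ 0 ∧ D.natAbs ≤ K ∧ ∃ n : Fin d → ℤ, (D : ℝ) • x = toReal n}

theorem finite_boundedFractions (d : ℕ) (ρ : ℝ) (K : ℕ) : (boundedFractions d ρ K).Finite := by
  let M : ℤ := ⌈K * ρ⌉
  refine (((Set.finite_Icc (-(K : ℤ)) K).prod
    (Set.finite_Icc (fun _ : Fin d => -M) (fun _ => M))).image
      (fun p => (p.1 : ℝ)⁻¹ • toReal p.2)).subset ?_
  rintro x ⟨hx, D, hD, hDK, n, hn⟩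
  have hD' : (D : ℝ) ≠ 0 := by exact_mod_cast hD
  have hDabs : |(D : ℝ)| ≤ K := by
    rw [← Int.cast_abs, Int.abs_eq_natAbs]; exact_mod_cast hDK
  have hnb : ∀ i, |n i| ≤ M := fun i => by
    have h1 : |(n i : ℝ)| ≤ K * ρ := by
      have h2 := congrFun hn i
      rw [Pi.smul_apply, smul_eq_mul, toReal_apply] at h2
      rw [← h2, abs_mul]
      have h3 : |x i| ≤ ρ := (norm_le_pi_norm x i).trans hx
      gcongr
    have : ((|n i| : ℤ) : ℝ) ≤ M := by
      push_cast
      exact h1.trans (Int.le_ceil _)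
    exact_mod_cast this
  refine ⟨(D, n), ⟨?_, ?_⟩, ?_⟩
  · rw [Set.mem_Icc, ← abs_le, Int.abs_eq_natAbs]; exact_mod_cast hDK
  · exact ⟨fun i => (abs_le.1 (hnb i)).1, fun i => (abs_le.1 (hnb i)).2⟩
  · change (D : ℝ)⁻¹ • toReal n = x
    rw [← hn, smul_smul, inv_mul_cancel₀ hD', one_smul]

theorem exists_hasCode (d m N : ℕ) : ∃ (ρ : ℝ) (K : ℕ), 1 ≤ ρ ∧
    ∀ P ∈ boundedGorensteinPolytopes d m N, ∃ c : Set (Fin d → ℝ) × Set (Fin d → ℝ),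
      HasCode ρ P c ∧ c.1 ⊆ boundedFractions d ρ K ∧ c.2 ⊆ boundedFractions d ρ K := by
  set K : ℕ := d ! * (m * d ^ d) ^ d with hK
  -- The bound of `norm_sub_le` with `N + 1` lattice points and `R = K`, since by Cramer's rule the
  -- edge vectors at `u` have coordinates at most `K`.
  set ρ₀ : ℝ := K * (1 + (N + 1 : ℕ) + d * (K * (5 * (N + 1 : ℕ)))) ^ (N + 1) with hρ₀
  refine ⟨max ρ₀ 1, K, le_max_right _ _, fun P hP => ?_⟩
  have hV := isLatticePointSet_latticePoints hP
  have hcard : (latticePoints P).ncard = N + 1 := by rw [ncard_latticePoints, hP.2.2.1]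
  obtain ⟨u, hu⟩ := exists_isVertex hV.finite hV.nonempty
  have hdet := fun u hu => natAbs_det_edgeVectors_le (u := u) hP hu
  obtain ⟨b, hbE, hb⟩ := exists_det_ne_zero_of_separates (separates_edgeVectors hV hu)
  have hfrac : ∀ z : Fin d → ℤ, ‖coords b (toReal z)‖ ≤ max ρ₀ 1 →
      coords b (toReal z) ∈ boundedFractions d (max ρ₀ 1) K := fun z hz =>
    ⟨hz, (Matrix.of b).det, hb, hdet u hu b hbE, _, det_smul_coords_toReal hb z⟩
  refine ⟨(_, _), ⟨u, b, hb, rfl, rfl⟩, ?_, ?_⟩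
  · rintro _ ⟨hx, z, rfl⟩
    exact hfrac z hx
  · rintro _ ⟨z, hz, rfl⟩
    refine hfrac _ (le_trans ?_ (le_max_left _ _))
    have := hV.norm_sub_le hdet (coords b) (R := K) (by positivity) hu (fun e he => by
      obtain ⟨c, hc, hec⟩ := exists_coeff_of_det_le (hdet u hu) hbE hb he
      rw [hec, ← uncoords_apply, coords_uncoords hb]
      exact (pi_norm_le_iff_of_nonneg (by positivity)).2 hc) z hz
    rwa [hcard] at this

end LatticePoly

theorem mainTheorem5 (d m N : ℕ) :
    ∃ S : Set (Set (Fin d → ℝ)), S.Finite ∧ S ⊆ LatticePoly.boundedGorensteinPolytopes d m N ∧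
      ∀ P ∈ LatticePoly.boundedGorensteinPolytopes d m N,
        ∃ Q ∈ S, LatticePoly.IntegrallyEquivalent P Q := by
  obtain ⟨ρ, K, hρ, hcode⟩ := LatticePoly.exists_hasCode d m N
  choose! code hcode hc₁ hc₂ using hcode
  set B := LatticePoly.boundedGorensteinPolytopes d m N with hB
  have hT := (LatticePoly.finite_boundedFractions d ρ K).finite_subsets
  have hfin : (code '' B).Finite := (hT.prod hT).subset (by
    rintro _ ⟨P, hP, rfl⟩
    exact ⟨hc₁ P hP, hc₂ P hP⟩)
  -- One polytope is chosen for each of the finitely many codes.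
  obtain ⟨S, hSB, hS⟩ := Set.exists_subset_bijOn B code
  refine ⟨S, hS.finite_iff_finite.2 hfin, hSB, fun P hP => ?_⟩
  obtain ⟨Q, hQ, hQP⟩ := hS.surjOn ⟨P, hP, rfl⟩
  refine ⟨Q, hQ, ?_⟩
  have hQB := hSB hQ
  have h1 := hcode Q hQB
  rw [hQP] at h1
  exact LatticePoly.integrallyEquivalent_of_hasCode hρ hP.1 hQB.1 hP.2.1 hQB.2.1 (hcode P hP) h1
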